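/- Let $d\ge 1$, $M\ge 2$ be integers, $p\in(M^{-\min\{3,d\}},1]$, and put $r=1/M$, $D=\log(M^dp)/\log M$. Divide $[0,1]^d$ into its $M^d$ closed subcubes $J_1,\dots,J_{M^d}$ of side length $1/M$, keep each of them independently with probability $p$, and repeat the procedure independently in every cube that was kept, and so on. Let $F_0=[0,1]^d$, let $F_n$ be the union of the cubes of side length $M^{-n}$ kept in the $n$-th step, and for $n\ge 1$ and $j\in\{1,\dots,M^d\}$ let $F_n^j$ be the union of those cubes kept in the $n$-th step that descend from (that is, are contained in) $J_j$. For $0\le k\le d$ let $V_k$ be the $k$-th intrinsic volume on the convex ring (finite unions of compact convex sets) of $\mathbb R^d$, that is, the additive extension of the coefficients in the Steiner formula $\mathrm{vol}(K_{\oplus\varepsilon})=\sum_{k=0}^d\varepsilon^{d-k}\kappa_{d-k}V_k(K)$ for compact convex $K$, where $\kappa_j$ is the volume of the unit ball of $\mathbb R^j$. Then for each $k\in\{0,\dots,d\}$ all the expectations below are well defined, the series below converge absolutely for each $T$, and the limit $$\overline{\mathcal V}_k(F):=\lim_{n\to\infty} r^{n(D-k)}\,\mathbb E V_k(F_n)$$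 exists and equals $$q_{d,k}+\sum_{T\subset\{1,\dots,M^d\},\ |T|\ge 2}(-1)^{|T|-1}\sum_{n=1}^\infty r^{n(D-k)}\,\mathbb E V_k\Big(\bigcap_{j\in T}F_n^j\Big),\qquad q_{d,k}:=V_k([0,1]^d).$$ -/

import Mathlib

open MeasureTheory ProbabilityTheory Filter Topology

namespace FractalPercolation

/-! ### Intrinsic volumes on the convex ring -/

/-- `ℝ^d` with the Euclidean norm. -/
abbrev E (d : ℕ) : Type := EuclideanSpace ℝ (Fin d)

/-- Compact polyconvex sets (the convex ring): finite unions of compact convex sets.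
The empty set is included. -/
def IsPolyconvex {d : ℕ} (K : Set (E d)) : Prop :=
  ∃ s : Finset (Set (E d)), (∀ C ∈ s, IsCompact C ∧ Convex ℝ C) ∧ K = ⋃ C ∈ s, C

/-- The volume `κ_j` of the Euclidean unit ball of `ℝ^j`. -/
noncomputable def ballVolume (j : ℕ) : ℝ := volume.real (Metric.closedBall (0 : E j) 1)

/-- `V` is the `k`-th intrinsic volume on the convex ring of `ℝ^d`: on a compact convex set its
value is the coefficient `a k` of the Steiner formula
`vol (K_ε) = ∑_{j=0}^d ε^(d-j) κ_{d-j} a j`, `ε ≥ 0`, and it is extended additively to compact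
polyconvex sets. (The closed thickening is the `ε`-parallel set. For `K = ∅` the Steiner clause
gives `V ∅ = 0`. By convention `V` is zero outside the convex ring, which makes it unique.) -/
structure IsIntrinsicVolume (d : ℕ) (k : Fin (d + 1)) (V : Set (E d) → ℝ) : Prop where
  steiner : ∀ K : Set (E d), IsCompact K → Convex ℝ K → ∀ a : ℕ → ℝ,
    (∀ ε : ℝ, 0 ≤ ε → volume.real (Metric.cthickening ε K) =
      ∑ j ∈ Finset.range (d + 1), ε ^ (d - j) * ballVolume (d - j) * a j) → V K = a k
  additive : ∀ K L : Set (E d), IsPolyconvex K → IsPolyconvex L →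
    V K + V L = V (K ∪ L) + V (K ∩ L)
  zero_of_not_polyconvex : ∀ K : Set (E d), ¬ IsPolyconvex K → V K = 0

/-! The following lemmas show that the additive extension exists. -/

lemma interval_sum {ι : Type*} (s : Finset ι) (c a b : ι → ℝ) (hab : ∀ i ∈ s, a i ≤ b i)
    (h : ∀ t : ℝ, ∑ i ∈ s, c i * (Set.Icc (a i) (b i)).indicator 1 t = 0) :
    ∑ i ∈ s, c i = 0 := by
  classical
  have hev : ∀ᶠ δ : ℝ in 𝓝[>] 0, ∀ i ∈ s, ∀ j ∈ s,
      (b i < b j → b i + δ < b j) ∧ (b i < a j → b i + δ < a j) := by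
    have key : ∀ u v : ℝ, ∀ᶠ δ : ℝ in 𝓝[>] 0, (u < v → u + δ < v) := by
      intro u v
      by_cases huv : u < v
      · have : Set.Ioo (0 : ℝ) (v - u) ∈ 𝓝[>] (0 : ℝ) := Ioo_mem_nhdsGT (by linarith)
        filter_upwards [this] with δ hδ _
        linarith [hδ.2]
      · exact Eventually.of_forall fun _ h => absurd h huv
    rw [Filter.eventually_all_finset]
    intro i _
    rw [Filter.eventually_all_finset]
    intro j _
    exact (key _ _).and (key _ _)
  obtain ⟨δ, hδ, hδ0⟩ := (hev.and self_mem_nhdsWithin).exists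
  have hδ0 : 0 < δ := hδ0
  have hin : ∀ i ∈ s, ∑ β ∈ s.image b, ((Set.Icc (a i) (b i)).indicator (1 : ℝ → ℝ) β
      - (Set.Icc (a i) (b i)).indicator (1 : ℝ → ℝ) (β + δ)) = 1 := by
    intro i hi
    rw [Finset.sum_eq_single (b i)]
    · have := hab i hi
      simp [this, hδ0]
    · intro β hβ hne
      obtain ⟨j, hj, rfl⟩ := Finset.mem_image.1 hβ
      have h1 := hδ j hj i hi
      simp only [Set.indicator_apply, Set.mem_Icc, Pi.one_apply]
      rcases lt_trichotomy (b j) (b i) with h2 | h2 | h2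
      · by_cases h3 : b j < a i
        · have := h1.2 h3
          rw [if_neg (by intro h; linarith [h.1]), if_neg (by intro h; linarith [h.1]), sub_self]
        · have := h1.1 h2
          rw [if_pos ⟨by linarith, by linarith⟩, if_pos ⟨by linarith, by linarith⟩, sub_self]
      · exact absurd h2 hne
      · rw [if_neg (by intro h; linarith [h.2]), if_neg (by intro h; linarith [h.2]), sub_self]
    · intro h
      exact absurd (Finset.mem_image_of_mem b hi) h
  calc ∑ i ∈ s, c i = ∑ i ∈ s, c i * ∑ β ∈ s.image b,
        ((Set.Icc (a i) (b i)).indicator (1 : ℝ → ℝ) β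
          - (Set.Icc (a i) (b i)).indicator (1 : ℝ → ℝ) (β + δ)) :=
        Finset.sum_congr rfl fun i hi => by rw [hin i hi, mul_one]
    _ = ∑ β ∈ s.image b, (∑ i ∈ s, c i * (Set.Icc (a i) (b i)).indicator 1 β
          - ∑ i ∈ s, c i * (Set.Icc (a i) (b i)).indicator 1 (β + δ)) := by
        simp_rw [Finset.mul_sum, mul_sub]
        rw [Finset.sum_comm]
        simp_rw [Finset.sum_sub_distrib]
    _ = 0 := by simp [h]

lemma euler_pi {ι : Type*} (d : ℕ) : ∀ (s : Finset ι) (c : ι → ℝ)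
    (K : ι → Set (Fin d → ℝ)), (∀ i ∈ s, IsCompact (K i)) → (∀ i ∈ s, Convex ℝ (K i)) →
    (∀ i ∈ s, (K i).Nonempty) → (∀ x, ∑ i ∈ s, c i * (K i).indicator 1 x = 0) →
    ∑ i ∈ s, c i = 0 := by
  classical
  induction d with
  | zero =>
    intro s c K _ _ hne h
    rw [← h 0]
    refine Finset.sum_congr rfl fun i hi => ?_
    obtain ⟨x, hx⟩ := hne i hi
    rw [Subsingleton.elim x 0] at hx
    have hi1 : (K i).indicator (1 : (Fin 0 → ℝ) → ℝ) 0 = 1 := Set.indicator_of_mem hx _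
    rw [hi1, mul_one]
  | succ d ih =>
    intro s c K hcpt hconv hne h
    have him : ∀ i, ∃ a b : ℝ, i ∈ s → a ≤ b ∧ (fun x : Fin (d + 1) → ℝ => x 0) '' K i
        = Set.Icc a b := by
      intro i
      by_cases hi : i ∈ s
      · have h1 : IsConnected ((fun x : Fin (d + 1) → ℝ => x 0) '' K i) :=
          ((hconv i hi).isConnected (hne i hi)).image _ (continuous_apply 0).continuousOn
        have h2 := (hcpt i hi).image (continuous_apply (A := fun _ : Fin (d + 1) => ℝ) 0)
        have h3 := eq_Icc_of_connected_compact h1 h2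
        refine ⟨_, _, fun _ => ⟨?_, h3⟩⟩
        rw [← Set.nonempty_Icc, ← h3]
        exact h1.nonempty
      · exact ⟨0, 0, fun h => absurd h hi⟩
    choose a b hab using him
    refine interval_sum s c a b (fun i hi => (hab i hi).1) fun t => ?_
    have hs := ih (s.filter fun i => t ∈ Set.Icc (a i) (b i)) c
      (fun i => {y | Fin.cons t y ∈ K i}) ?_ ?_ ?_ ?_
    · rw [Finset.sum_filter] at hs
      rw [← hs]
      refine Finset.sum_congr rfl fun i _ => ?_
      by_cases ht : t ∈ Set.Icc (a i) (b i) <;> simp [ht]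
    · intro i hi
      have hK := hcpt i (Finset.mem_filter.1 hi).1
      have : IsClosed {y : Fin d → ℝ | (Fin.cons t y : Fin (d + 1) → ℝ) ∈ K i} :=
        hK.isClosed.preimage (by fun_prop)
      refine ((hK.image (f := fun x : Fin (d + 1) → ℝ => Fin.tail x)
        (by unfold Fin.tail; fun_prop))).of_isClosed_subset this ?_
      intro y hy
      exact ⟨_, hy, by simp⟩
    · intro i hi y hy z hz u v hu hv huv
      have := hconv i (Finset.mem_filter.1 hi).1 hy hz hu hv huv
      have he : u • (Fin.cons t y : Fin (d + 1) → ℝ) + v • (Fin.cons t z : Fin (d + 1) → ℝ)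
          = Fin.cons t (u • y + v • z) := by
        ext j
        refine Fin.cases ?_ (fun j => ?_) j
        · simp [← add_mul, huv]
        · simp
      rw [he] at this
      exact this
    · intro i hi
      obtain ⟨hi, ht⟩ := Finset.mem_filter.1 hi
      rw [← (hab i hi).2] at ht
      obtain ⟨x, hx, rfl⟩ := ht
      exact ⟨Fin.tail x, by simpa using hx⟩
    · intro y
      rw [← h (Fin.cons t y), Finset.sum_filter]
      refine Finset.sum_congr rfl fun i hi => ?_
      split_ifs with ht
      · rfl
      · have : (Fin.cons t y : Fin (d + 1) → ℝ) ∉ K i := by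
          intro hx
          apply ht
          rw [← (hab i hi).2]
          exact ⟨_, hx, by simp⟩
        simp [this]

lemma ballVolume_pos (j : ℕ) : 0 < ballVolume j :=
  ENNReal.toReal_pos (Metric.measure_closedBall_pos volume _ one_pos).ne'
    (isCompact_closedBall _ _).measure_lt_top.ne

lemma euler_euclidean {ι : Type*} {d : ℕ} (s : Finset ι) (c : ι → ℝ) (K : ι → Set (E d))
    (hcpt : ∀ i ∈ s, IsCompact (K i)) (hconv : ∀ i ∈ s, Convex ℝ (K i))
    (hne : ∀ i ∈ s, (K i).Nonempty) (h : ∀ x, ∑ i ∈ s, c i * (K i).indicator 1 x = 0) :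
    ∑ i ∈ s, c i = 0 := by
  refine euler_pi d s c (fun i => (EuclideanSpace.equiv (Fin d) ℝ).symm ⁻¹' K i)
    (fun i hi => ?_) (fun i hi => ?_) (fun i hi => ?_) (fun x => ?_)
  · exact (EuclideanSpace.equiv (Fin d) ℝ).symm.toHomeomorph.isCompact_preimage.2 (hcpt i hi)
  · exact (hconv i hi).linear_preimage
      ((EuclideanSpace.equiv (Fin d) ℝ).symm : (Fin d → ℝ) →L[ℝ] E d).toLinearMap
  · exact (hne i hi).preimage (EuclideanSpace.equiv (Fin d) ℝ).symm.surjective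
  · rw [← h ((EuclideanSpace.equiv (Fin d) ℝ).symm x)]
    rfl

lemma cthickening_relation {ι : Type*} {d : ℕ} (s : Finset ι) (c : ι → ℝ) (K : ι → Set (E d))
    (hcpt : ∀ i ∈ s, IsCompact (K i)) (hconv : ∀ i ∈ s, Convex ℝ (K i))
    (h : ∀ x, ∑ i ∈ s, c i * (K i).indicator 1 x = 0) (ε : ℝ) (hε : 0 ≤ ε) :
    ∑ i ∈ s, c i * volume.real (Metric.cthickening ε (K i)) = 0 := by
  classical
  have hpt : ∀ x, ∑ i ∈ s, c i * (Metric.cthickening ε (K i)).indicator 1 x = 0 := by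
    intro x
    have hmem : ∀ i ∈ s, (x ∈ Metric.cthickening ε (K i) ↔
        (K i ∩ Metric.closedBall x ε).Nonempty) := by
      intro i hi
      rw [(hcpt i hi).cthickening_eq_biUnion_closedBall hε]
      simp only [Set.mem_iUnion, exists_prop]
      constructor
      · rintro ⟨y, hy, hxy⟩
        exact ⟨y, hy, Metric.mem_closedBall_comm.1 hxy⟩
      · rintro ⟨y, hy, hxy⟩
        exact ⟨y, hy, Metric.mem_closedBall_comm.1 hxy⟩
    have h1 := euler_euclidean (s.filter fun i => (K i ∩ Metric.closedBall x ε).Nonempty) c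
      (fun i => K i ∩ Metric.closedBall x ε)
      (fun i hi => (hcpt i (Finset.mem_filter.1 hi).1).inter_right Metric.isClosed_closedBall)
      (fun i hi => (hconv i (Finset.mem_filter.1 hi).1).inter (convex_closedBall _ _))
      (fun i hi => (Finset.mem_filter.1 hi).2) ?_
    · rw [Finset.sum_filter] at h1
      rw [← h1]
      refine Finset.sum_congr rfl fun i hi => ?_
      by_cases hx : x ∈ Metric.cthickening ε (K i)
      · rw [if_pos ((hmem i hi).1 hx)]
        simp [hx]
      · rw [if_neg (fun h => hx ((hmem i hi).2 h))]
        simp [hx]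
    · intro y
      rw [Finset.sum_filter]
      by_cases hy : y ∈ Metric.closedBall x ε
      · refine Eq.trans ?_ (h y)
        refine Finset.sum_congr rfl fun i _ => ?_
        by_cases hK : y ∈ K i
        · rw [if_pos ⟨y, hK, hy⟩]
          simp only [Set.indicator_apply, Set.mem_inter_iff, hK, hy, and_self]
        · simp only [Set.indicator_apply, Set.mem_inter_iff, hK, false_and, if_false, mul_zero,
            ite_self]
      · refine Finset.sum_eq_zero fun i _ => ?_
        simp only [Set.indicator_apply, Set.mem_inter_iff, hy, and_false, if_false, mul_zero,
          ite_self]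
  have hint : ∀ i ∈ s, Integrable
      (fun x => c i * (Metric.cthickening ε (K i)).indicator (1 : E d → ℝ) x) volume := by
    intro i hi
    refine Integrable.const_mul ?_ _
    rw [integrable_indicator_iff Metric.isClosed_cthickening.measurableSet]
    exact integrableOn_const (hs := (hcpt i hi).cthickening.measure_lt_top.ne)
  calc ∑ i ∈ s, c i * volume.real (Metric.cthickening ε (K i))
      = ∑ i ∈ s, ∫ x, c i * (Metric.cthickening ε (K i)).indicator (1 : E d → ℝ) x := by
        refine Finset.sum_congr rfl fun i _ => ?_
        rw [integral_const_mul, integral_indicator_one Metric.isClosed_cthickening.measurableSet]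
    _ = ∫ x, ∑ i ∈ s, c i * (Metric.cthickening ε (K i)).indicator (1 : E d → ℝ) x :=
        (integral_finsetSum s hint).symm
    _ = 0 := by simp [hpt]

open Polynomial in
lemma exists_isIntrinsicVolume (d : ℕ) (k : Fin (d + 1)) : ∃ V, IsIntrinsicVolume d k V := by
  classical
  let W : (ℕ → ℝ) →ₗ[ℝ] ℝ := (ballVolume (d - k))⁻¹ • (Polynomial.lcoeff ℝ (d - k)).comp
    (Lagrange.interpolate (Finset.range (d + 1)) (fun i : ℕ => (i : ℝ)))
  let vols : Set (E d) → ℕ → ℝ := fun K i => volume.real (Metric.cthickening (i : ℝ) K)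
  let Body := {C : Set (E d) // IsCompact C ∧ Convex ℝ C}
  let A : (Body →₀ ℝ) →ₗ[ℝ] (E d → ℝ) :=
    Finsupp.linearCombination ℝ (fun C : Body => C.1.indicator (1 : E d → ℝ))
  let B : (Body →₀ ℝ) →ₗ[ℝ] (ℕ → ℝ) := Finsupp.linearCombination ℝ (fun C : Body => vols C.1)
  have hker : ∀ f, A f = 0 → B f = 0 := by
    intro f hf
    ext i
    have h1 := cthickening_relation f.support f (fun C : Body => C.1)
      (fun C _ => C.2.1) (fun C _ => C.2.2) (fun x => ?_) (i : ℝ) (Nat.cast_nonneg i)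
    · simpa [B, Finsupp.linearCombination_apply, Finsupp.sum, Finset.sum_apply, vols] using h1
    · have := congrFun hf x
      simpa [A, Finsupp.linearCombination_apply, Finsupp.sum, Finset.sum_apply] using this
  obtain ⟨L, hL⟩ : ∃ L : (E d → ℝ) →ₗ[ℝ] ℝ, L.comp A = W.comp B := by
    have : W.comp B ∈ LinearMap.range A.dualMap := by
      rw [LinearMap.range_dualMap_eq_dualAnnihilator_ker, Submodule.mem_dualAnnihilator]
      intro f hf
      simp [hker f hf]
    exact this
  have hLC : ∀ C : Set (E d), IsCompact C → Convex ℝ C →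
      L (C.indicator (1 : E d → ℝ)) = W (vols C) := by
    intro C h1 h2
    have := LinearMap.congr_fun hL (Finsupp.single (⟨C, h1, h2⟩ : Body) 1)
    simpa [A, B] using this
  have hpc : ∀ K L : Set (E d), IsPolyconvex K → IsPolyconvex L →
      IsPolyconvex (K ∪ L) ∧ IsPolyconvex (K ∩ L) := by
    rintro _ _ ⟨s, hs, rfl⟩ ⟨t, ht, rfl⟩
    refine ⟨⟨s ∪ t, fun C hC => ?_, ?_⟩, ⟨Finset.image₂ (· ∩ ·) s t, fun C hC => ?_, ?_⟩⟩
    · rcases Finset.mem_union.1 hC with h | h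
      exacts [hs C h, ht C h]
    · rw [Finset.set_biUnion_union]
    · obtain ⟨P, hP, Q, hQ, rfl⟩ := Finset.mem_image₂.1 hC
      exact ⟨(hs P hP).1.inter (ht Q hQ).1, (hs P hP).2.inter (ht Q hQ).2⟩
    · ext x
      simp only [Set.mem_inter_iff, Set.mem_iUnion, Finset.mem_image₂, exists_prop]
      constructor
      · rintro ⟨⟨P, hP, hx⟩, ⟨Q, hQ, hy⟩⟩
        exact ⟨_, ⟨P, hP, Q, hQ, rfl⟩, hx, hy⟩
      · rintro ⟨_, ⟨P, hP, Q, hQ, rfl⟩, hx, hy⟩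
        exact ⟨⟨P, hP, hx⟩, ⟨Q, hQ, hy⟩⟩
  refine ⟨fun K => if IsPolyconvex K then L (K.indicator 1) else 0, ?_, ?_, ?_⟩
  · intro K h1 h2 a ha
    have hK : IsPolyconvex K := ⟨{K}, by simpa using ⟨h1, h2⟩, by simp⟩
    simp only [if_pos hK]
    rw [hLC K h1 h2]
    let P : ℝ[X] := ∑ j ∈ Finset.range (d + 1), C (ballVolume (d - j) * a j) * X ^ (d - j)
    have hdeg : P.degree < (Finset.range (d + 1)).card := by
      rw [Finset.card_range]
      refine (Polynomial.degree_sum_le _ _).trans_lt ?_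
      rw [Finset.sup_lt_iff (by exact WithBot.bot_lt_coe _)]
      intro j _
      refine (Polynomial.degree_C_mul_X_pow_le _ _).trans_lt ?_
      exact_mod_cast Nat.lt_succ_of_le (Nat.sub_le d j)
    have hint : P = Lagrange.interpolate (Finset.range (d + 1)) (fun i : ℕ => (i : ℝ)) (vols K) := by
      refine Lagrange.eq_interpolate_of_eval_eq _ (fun i _ j _ h => by exact_mod_cast h) hdeg ?_
      intro i _
      simp only [vols, P]
      rw [ha i (Nat.cast_nonneg i), Polynomial.eval_finsetSum]
      refine Finset.sum_congr rfl fun j _ => ?_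
      simp
      ring
    have hco : P.coeff (d - k) = ballVolume (d - k) * a k := by
      simp only [P, Polynomial.finsetSum_coeff, Polynomial.coeff_C_mul_X_pow]
      rw [Finset.sum_eq_single (k : ℕ)]
      · simp
      · intro j hj hne
        have := Finset.mem_range.1 hj
        have := k.2
        rw [if_neg (by omega)]
      · intro h
        exact absurd (Finset.mem_range.2 k.2) h
    simp only [W, LinearMap.smul_apply, LinearMap.comp_apply, Polynomial.lcoeff_apply, ← hint,
      hco, smul_eq_mul]
    rw [inv_mul_cancel_left₀ (ballVolume_pos _).ne']
  · intro K K' hK hK'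
    simp only [if_pos hK, if_pos hK', if_pos (hpc K K' hK hK').1, if_pos (hpc K K' hK hK').2]
    rw [← map_add, ← map_add, Set.indicator_union_add_inter]
  · intro K hK
    simp only [if_neg hK]

/-- The `k`-th intrinsic volume `V_k` on the convex ring of `ℝ^d`, `0 ≤ k ≤ d`. -/
noncomputable def intrinsicVolume (d : ℕ) (k : Fin (d + 1)) : Set (E d) → ℝ :=
  Classical.choose (exists_isIntrinsicVolume d k)

lemma isIntrinsicVolume_intrinsicVolume (d : ℕ) (k : Fin (d + 1)) :
    IsIntrinsicVolume d k (intrinsicVolume d k) :=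
  Classical.choose_spec (exists_isIntrinsicVolume d k)

/-! ### Fractal percolation -/

/-- The index set of the `M^d` subcubes of the first subdivision of `[0,1]^d`. -/
abbrev Letter (d M : ℕ) : Type := Fin d → Fin M

/-- The unit cube `[0,1]^d`. -/
def unitCube (d : ℕ) : Set (E d) := {x | ∀ i, x i ∈ Set.Icc (0 : ℝ) 1}

/-- The similarity `φ_j : x ↦ (x + j) / M`, which maps the unit cube onto its `j`-th subcube of
side length `1 / M`. -/
noncomputable def phi {d M : ℕ} (j : Letter d M) (x : E d) : E d :=
  WithLp.toLp 2 fun i => (x i + ((j i : ℕ) : ℝ)) / (M : ℝ)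

/-- The cube `J_σ = φ_{σ₁} (φ_{σ₂} (⋯ φ_{σₙ} ([0,1]^d)))` of side length `M ^ (-n)` addressed by
a word `σ` of length `n`. -/
def cube {d M : ℕ} : List (Letter d M) → Set (E d)
  | [] => unitCube d
  | j :: σ => phi j '' cube σ

/-- `I σ ω` is the random set of indices `j` such that the subcube `J_{σj}` of `J_σ` is kept:
all these decisions are independent, and each subcube is kept with probability `p`. -/
structure IsFractalPercolation {d M : ℕ} {Ω : Type*} [MeasurableSpace Ω] (μ : Measure Ω) (p : ℝ)
    (I : List (Letter d M) → Ω → Set (Letter d M)) : Prop where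
  measurableSet : ∀ σ j, MeasurableSet {ω | j ∈ I σ ω}
  prob : ∀ σ j, μ.real {ω | j ∈ I σ ω} = p
  indep : iIndepSet (fun q : List (Letter d M) × Letter d M => {ω | q.2 ∈ I q.1 ω}) μ

/-- The `n`-th generation `𝒯_n` of the random tree: the words of length `n` all of whose prefixes
have been kept. -/
def tree {d M : ℕ} {Ω : Type*} (I : List (Letter d M) → Ω → Set (Letter d M)) (ω : Ω) :
    ℕ → Set (List (Letter d M))
  | 0 => {[]}
  | n + 1 => {τ | ∃ σ ∈ tree I ω n, ∃ j ∈ I σ ω, τ = σ ++ [j]}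

/-- The construction step `F_n`. -/
def step {d M : ℕ} {Ω : Type*} (I : List (Letter d M) → Ω → Set (Letter d M)) (n : ℕ) (ω : Ω) :
    Set (E d) :=
  ⋃ σ ∈ tree I ω n, cube σ

/-- The part `F_n^j` of `F_n`, for `n ≥ 1`: the union of the cubes `J_σ`, `σ ∈ 𝒯_n`, whose
first letter is `j`. -/
def stepPart {d M : ℕ} {Ω : Type*} (I : List (Letter d M) → Ω → Set (Letter d M))
    (j : Letter d M) (n : ℕ) (ω : Ω) : Set (E d) :=
  ⋃ σ ∈ {τ ∈ tree I ω n | τ.head? = some j}, cube σ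

/-- The dimension `D = log (M^d p) / log M`. -/
noncomputable def dimension (d M : ℕ) (p : ℝ) : ℝ :=
  Real.log ((M : ℝ) ^ d * p) / Real.log M

end FractalPercolation

open FractalPercolation

/-! Inclusion–exclusion over the first letter turns `E V_k(F_{n+1})` into a linear recursion. The
singletons contribute `M^d p r^k E V_k(F_n)`: given that `J_j` is kept, `F_{n+1}^j` is the image
under `phi j` of a copy of `F_n`, and `V_k` scales by `r^k`. The sets `T` with `|T| ≥ 2` contribute
the inhomogeneous terms. Since `M^D = M^d p`, the factor `r^{n(D-k)}` normalises the linear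
coefficient to `1`, so the rescaled expectation is exactly `V_k([0,1]^d)` plus partial sums of the
series in the formula. Only absolute convergence remains.

For convergence, fix `j ≠ l` in `T`. At level `n`, at most `2 M^{n(d-1)}` cubes in `J_j` touch `J_l`
(`card_boundaryWords_le`). A cube below `j` and one below `l` share no random decision, so both
survive with probability `p^{2n}` (`disjoint_edges`). The intersection of the parts is a union of
boxes of side at most `M^{-n}`, each meeting boundedly many others, so `|V_k|` is at most a constant
times the number of boxes times `M^{-nk}` (`abs_intrinsicVolume_biUnion_le`). After rescaling, the
terms are `O((p/M)^n)`.

Values of `V_k` are needed only on boxes. There the Steiner polynomial is computed explicitly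
(`steiner_box`); bounds and homogeneity then pass to finite unions by inclusion–exclusion. -/

namespace FractalPercolation

/-! ### The Steiner formula for boxes -/

/-- The distance of `t` to the interval `[a, b]`. -/
noncomputable def gap (a b t : ℝ) : ℝ := max (max (a - t) (t - b)) 0

lemma continuous_gap (a b : ℝ) : Continuous (gap a b) := by
  unfold gap; fun_prop

/-- The parallel set of a box at distance `√s`. -/
def nearBox {d : ℕ} (a b : Fin d → ℝ) (s : ℝ) : Set (Fin d → ℝ) :=
  {x | ∑ i, gap (a i) (b i) (x i) ^ 2 ≤ s}

lemma measurableSet_nearBox {d : ℕ} (a b : Fin d → ℝ) (s : ℝ) : MeasurableSet (nearBox a b s) := by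
  refine measurableSet_le (Continuous.measurable ?_) measurable_const
  exact continuous_finsetSum _ fun i _ => ((continuous_gap _ _).comp (continuous_apply i)).pow 2

lemma gap_of_le_left {a b t : ℝ} (hab : a ≤ b) (h : t ≤ a) : gap a b t = a - t := by
  rw [gap, max_eq_left (by linarith : t - b ≤ a - t), max_eq_left (by linarith)]

lemma gap_of_ge_right {a b t : ℝ} (hab : a ≤ b) (h : b ≤ t) : gap a b t = t - b := by
  rw [gap, max_eq_right (by linarith : a - t ≤ t - b), max_eq_left (by linarith)]

lemma gap_of_mem {a b t : ℝ} (h1 : a ≤ t) (h2 : t ≤ b) : gap a b t = 0 :=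
  max_eq_right (max_le (by linarith) (by linarith))

/-- The gap vanishes on `[a, b]`, and translation moves the two outer half-lines to those of the
degenerate interval `[0, 0]`. Applying `key` to both intervals identifies the outer contributions.
-/
lemma lintegral_gap {F : ℝ → ENNReal} (hF : Measurable F) {a b : ℝ} (hab : a ≤ b) :
    ∫⁻ t, F (gap a b t) = ENNReal.ofReal (b - a) * F 0 + ∫⁻ t, F (gap 0 0 t) := by
  have hm : Measurable fun t => F (gap 0 0 t) := hF.comp (continuous_gap 0 0).measurable
  have key : ∀ a b : ℝ, a ≤ b → ∫⁻ t, F (gap a b t) = ENNReal.ofReal (b - a) * F 0 +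
      ((∫⁻ t, (Set.Iio 0).indicator (fun t => F (gap 0 0 t)) t) +
        ∫⁻ t, (Set.Ioi 0).indicator (fun t => F (gap 0 0 t)) t) := by
    intro a b hab
    have hpt : ∀ t, F (gap a b t) = (Set.Icc a b).indicator (fun _ => F 0) t +
        ((Set.Iio 0).indicator (fun t => F (gap 0 0 t)) (t - a) +
          (Set.Ioi 0).indicator (fun t => F (gap 0 0 t)) (t - b)) := by
      intro t
      simp only [Set.indicator_apply, Set.mem_Icc, Set.mem_Iio, Set.mem_Ioi]
      rcases lt_or_ge t a with h1 | h1
      · rw [if_neg (by intro h; linarith [h.1]), if_pos (by linarith), if_neg (by linarith),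
          zero_add, add_zero, gap_of_le_left hab h1.le, gap_of_le_left le_rfl (by linarith)]
        congr 1
        ring
      · rcases le_or_gt t b with h2 | h2
        · rw [if_pos ⟨h1, h2⟩, if_neg (by linarith), if_neg (by linarith), add_zero, add_zero,
            gap_of_mem h1 h2]
        · rw [if_neg (by intro h; linarith [h.2]), if_neg (by linarith), if_pos (by linarith),
            zero_add, zero_add, gap_of_ge_right hab h2.le, gap_of_ge_right le_rfl (by linarith),
            sub_zero]
    simp_rw [hpt]
    rw [lintegral_add_left (measurable_const.indicator measurableSet_Icc),
      lintegral_add_left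
        (by exact (hm.indicator measurableSet_Iio).comp (measurable_id.sub_const a)),
      lintegral_sub_right_eq_self, lintegral_sub_right_eq_self,
      lintegral_indicator_const measurableSet_Icc, Real.volume_Icc, mul_comm]
  rw [key a b hab, key 0 0 le_rfl]
  simp

/-- Fubini in the first coordinate. With the squared radius as parameter every slice is again a
`nearBox`; a negative parameter simply gives the empty set. -/
lemma volume_nearBox_succ {d : ℕ} (a b : Fin (d + 1) → ℝ) (s : ℝ) :
    volume (nearBox a b s) =
      ∫⁻ t, volume (nearBox (Fin.tail a) (Fin.tail b) (s - gap (a 0) (b 0) t ^ 2)) := by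
  have h := (volume_preserving_piFinSuccAbove (fun _ : Fin (d + 1) => ℝ) 0).symm
  rw [← h.measure_preimage (measurableSet_nearBox a b s).nullMeasurableSet,
    Measure.volume_eq_prod,
    Measure.prod_apply ((MeasurableEquiv.measurable _) (measurableSet_nearBox a b s))]
  refine lintegral_congr fun t => ?_
  congr 1
  ext x
  simp only [Set.mem_preimage, nearBox, Set.mem_ofPred_eq, Fin.sum_univ_succ]
  simp only [MeasurableEquiv.piFinSuccAbove, Fin.insertNthEquiv, Fin.tail]
  simp [le_sub_iff_add_le, add_comm]

lemma measurable_volume_nearBox {d : ℕ} (a b : Fin d → ℝ) :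
    Measurable fun s => volume (nearBox a b s) := by
  refine Monotone.measurable fun s t hst => measure_mono fun x hx => ?_
  exact le_trans hx hst

/-- The generating polynomial `∏ (1 + l_i X)` of the intrinsic volumes of a box with side
lengths `l_i`. -/
noncomputable def boxPoly {d : ℕ} (l : Fin d → ℝ) : Polynomial ℝ :=
  ∏ i, (1 + Polynomial.C (l i) * Polynomial.X)

lemma boxPoly_coeff_zero {d : ℕ} (l : Fin d → ℝ) : (boxPoly l).coeff 0 = 1 := by
  simp [boxPoly, Polynomial.coeff_zero_prod]

lemma boxPoly_coeff_succ {d : ℕ} (l : Fin (d + 1) → ℝ) (j : ℕ) :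
    (boxPoly l).coeff (j + 1) =
      (boxPoly (Fin.tail l)).coeff (j + 1) + l 0 * (boxPoly (Fin.tail l)).coeff j := by
  rw [boxPoly, Fin.prod_univ_succ, add_mul, one_mul, Polynomial.coeff_add, mul_assoc,
    Polynomial.coeff_C_mul, Polynomial.coeff_X_mul]
  rfl

lemma boxPoly_coeff_eq_zero {d : ℕ} (l : Fin d → ℝ) {j : ℕ} (hj : d < j) :
    (boxPoly l).coeff j = 0 := by
  induction d generalizing j with
  | zero =>
    simp [boxPoly, Polynomial.coeff_one, hj.ne']
  | succ d ih =>
    obtain ⟨j, rfl⟩ := Nat.exists_eq_succ_of_ne_zero (by omega : j ≠ 0)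
    rw [Nat.succ_eq_add_one, boxPoly_coeff_succ, ih _ (by omega), ih _ (by omega)]
    simp

lemma boxPoly_coeff_nonneg {d : ℕ} {l : Fin d → ℝ} (hl : ∀ i, 0 ≤ l i) (j : ℕ) :
    0 ≤ (boxPoly l).coeff j := by
  induction d generalizing j with
  | zero => simp only [boxPoly, Finset.univ_eq_empty, Finset.prod_empty, Polynomial.coeff_one]
            split_ifs <;> norm_num
  | succ d ih =>
    cases j with
    | zero => simp [boxPoly_coeff_zero]
    | succ j =>
      rw [boxPoly_coeff_succ]
      exact add_nonneg (ih (fun i => hl _) _) (mul_nonneg (hl 0) (ih (fun i => hl _) _))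

lemma boxPoly_coeff_le {d : ℕ} {l : Fin d → ℝ} (hl : ∀ i, 0 ≤ l i) (hl1 : ∀ i, l i ≤ 1) (j : ℕ) :
    (boxPoly l).coeff j ≤ 2 ^ d := by
  induction d generalizing j with
  | zero => simp only [boxPoly, Finset.univ_eq_empty, Finset.prod_empty, Polynomial.coeff_one]
            split_ifs <;> norm_num
  | succ d ih =>
    cases j with
    | zero => rw [boxPoly_coeff_zero]; exact one_le_pow₀ (by norm_num)
    | succ j =>
      rw [boxPoly_coeff_succ]
      have h1 := ih (l := Fin.tail l) (fun i => hl _) (fun i => hl1 _) (j + 1)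
      have h2 := ih (l := Fin.tail l) (fun i => hl _) (fun i => hl1 _) j
      have h3 := boxPoly_coeff_nonneg (l := Fin.tail l) (fun i => hl _) j
      have h4 := mul_le_of_le_one_left h3 (hl1 0)
      rw [pow_succ]
      linarith

lemma boxPoly_coeff_smul {d : ℕ} (c : ℝ) (l : Fin d → ℝ) (j : ℕ) :
    (boxPoly fun i => c * l i).coeff j = c ^ j * (boxPoly l).coeff j := by
  induction d generalizing j with
  | zero => cases j <;> simp [boxPoly, Polynomial.coeff_one]
  | succ d ih =>
    cases j with
    | zero => simp [boxPoly_coeff_zero]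
    | succ j =>
      have ht : Fin.tail (fun i => c * l i) = fun i => c * Fin.tail l i := rfl
      rw [boxPoly_coeff_succ, boxPoly_coeff_succ, ht, ih, ih]
      ring

/-- Induction by slicing: by `lintegral_gap`, the first side contributes either its length times a
ball of the same dimension, or a ball of one dimension more. This is the recursion for multiplying
`boxPoly` by `1 + l_0 X`. -/
lemma volume_nearBox {d : ℕ} (a b : Fin d → ℝ) (hab : ∀ i, a i ≤ b i) (s : ℝ) :
    volume (nearBox a b s) = ∑ j ∈ Finset.range (d + 1),
      ENNReal.ofReal ((boxPoly fun i => b i - a i).coeff j) *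
        volume (nearBox (0 : Fin (d - j) → ℝ) 0 s) := by
  induction d generalizing s with
  | zero =>
    simp only [zero_add, Finset.range_one, Finset.sum_singleton, boxPoly_coeff_zero,
      ENNReal.ofReal_one, one_mul, nearBox, Finset.univ_eq_empty, Finset.sum_empty]
    rfl
  | succ d ih =>
    set l : Fin (d + 1) → ℝ := fun i => b i - a i with hl
    have hl0 : ∀ i, 0 ≤ l i := fun i => sub_nonneg.2 (hab i)
    have hc := fun j => boxPoly_coeff_nonneg (l := Fin.tail l) (fun i => hl0 _) j
    let B : ℕ → ENNReal := fun m => volume (nearBox (0 : Fin m → ℝ) 0 s)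
    have hB : ∀ m, ∫⁻ t, volume (nearBox (0 : Fin m → ℝ) 0 (s - gap 0 0 t ^ 2)) = B (m + 1) := by
      intro m
      simp only [B]
      rw [volume_nearBox_succ]
      rfl
    have hmeas : ∀ m, Measurable fun u : ℝ => volume (nearBox (0 : Fin m → ℝ) 0 (s - u ^ 2)) :=
      fun m => (measurable_volume_nearBox _ _).comp (by fun_prop)
    have ih' : ∀ s, volume (nearBox (Fin.tail a) (Fin.tail b) s) = ∑ j ∈ Finset.range (d + 1),
      ENNReal.ofReal ((boxPoly (Fin.tail l)).coeff j) *
        volume (nearBox (0 : Fin (d - j) → ℝ) 0 s) := fun s => ih _ _ (fun i => hab _) s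
    rw [volume_nearBox_succ]
    simp_rw [ih']
    rw [lintegral_finsetSum]
    swap
    · intro j _
      exact ((hmeas (d - j)).comp (continuous_gap _ _).measurable).const_mul _
    have hterm : ∀ j, ∫⁻ t, ENNReal.ofReal ((boxPoly (Fin.tail l)).coeff j) *
        volume (nearBox (0 : Fin (d - j) → ℝ) 0 (s - gap (a 0) (b 0) t ^ 2)) =
        ENNReal.ofReal (l 0 * (boxPoly (Fin.tail l)).coeff j) * B (d - j) +
        ENNReal.ofReal ((boxPoly (Fin.tail l)).coeff j) * B (d - j + 1) := by
      intro j
      rw [lintegral_const_mul]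
      swap
      · exact (hmeas (d - j)).comp (continuous_gap _ _).measurable
      have := lintegral_gap (hmeas (d - j)) (hab 0)
      rw [this, hB, mul_add, ENNReal.ofReal_mul (hl0 0)]
      simp only [ne_eq, OfNat.ofNat_ne_zero, not_false_eq_true, zero_pow, sub_zero, B, hl]
      ring
    simp_rw [hterm]
    -- The degree bound allows a vanishing top term to be added, so that the sum can be reindexed by
    -- `j ↦ j + 1`.
    have hlast : ENNReal.ofReal ((boxPoly (Fin.tail l)).coeff (d + 1)) = 0 := by
      rw [boxPoly_coeff_eq_zero _ (Nat.lt_succ_self d), ENNReal.ofReal_zero]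
    have hA : ∑ j ∈ Finset.range (d + 1),
        ENNReal.ofReal ((boxPoly (Fin.tail l)).coeff j) * B (d - j + 1) =
        ∑ j ∈ Finset.range (d + 1), ENNReal.ofReal ((boxPoly (Fin.tail l)).coeff (j + 1)) *
          B (d - j) + B (d + 1) := by
      have h1 : ∑ j ∈ Finset.range (d + 2),
          ENNReal.ofReal ((boxPoly (Fin.tail l)).coeff j) * B (d + 1 - j) =
          ∑ j ∈ Finset.range (d + 1),
            ENNReal.ofReal ((boxPoly (Fin.tail l)).coeff j) * B (d - j + 1) := by
        rw [Finset.sum_range_succ, hlast, zero_mul, add_zero]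
        refine Finset.sum_congr rfl fun j hj => ?_
        rw [Nat.sub_add_comm (Nat.lt_succ_iff.1 (Finset.mem_range.1 hj))]
      rw [← h1, Finset.sum_range_succ']
      simp [boxPoly_coeff_zero]
    rw [Finset.sum_add_distrib, hA, Finset.sum_range_succ' _ (d + 1), ← add_assoc,
      ← Finset.sum_add_distrib]
    congr 1
    · refine Finset.sum_congr rfl fun j _ => ?_
      rw [boxPoly_coeff_succ, ENNReal.ofReal_add (hc _) (mul_nonneg (hl0 0) (hc _)), ← add_mul,
        add_comm, Nat.add_sub_add_right]
    · simp [boxPoly_coeff_zero, B]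

/-! ### Boxes in Euclidean space and their parallel sets -/

/-- The box `∏ [a_i, b_i]`. -/
def box {d : ℕ} (a b : Fin d → ℝ) : Set (E d) := {x | ∀ i, x i ∈ Set.Icc (a i) (b i)}

lemma box_eq_preimage {d : ℕ} (a b : Fin d → ℝ) :
    box a b = EuclideanSpace.equiv (Fin d) ℝ ⁻¹' Set.Icc a b := by
  ext x
  simp only [box, Set.mem_ofPred_eq, Set.mem_preimage, Set.mem_Icc, Pi.le_def, ← forall_and]
  rfl

lemma isCompact_box {d : ℕ} (a b : Fin d → ℝ) : IsCompact (box a b) := by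
  rw [box_eq_preimage]
  exact (EuclideanSpace.equiv (Fin d) ℝ).toHomeomorph.isCompact_preimage.2 isCompact_Icc

lemma convex_box {d : ℕ} (a b : Fin d → ℝ) : Convex ℝ (box a b) := by
  rw [box_eq_preimage]
  exact (convex_Icc a b).linear_preimage
    ((EuclideanSpace.equiv (Fin d) ℝ) : E d →L[ℝ] (Fin d → ℝ)).toLinearMap

lemma box_inter {d : ℕ} (a b a' b' : Fin d → ℝ) :
    box a b ∩ box a' b' = box (a ⊔ a') (b ⊓ b') := by
  rw [box_eq_preimage, box_eq_preimage, box_eq_preimage, ← Set.preimage_inter, Set.Icc_inter_Icc]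

lemma box_eq_empty {d : ℕ} {a b : Fin d → ℝ} (h : ¬ ∀ i, a i ≤ b i) : box a b = ∅ := by
  rw [box_eq_preimage, Set.Icc_eq_empty h, Set.preimage_empty]

lemma cthickening_box {d : ℕ} {a b : Fin d → ℝ} (hab : ∀ i, a i ≤ b i) {ε : ℝ} (hε : 0 ≤ ε) :
    Metric.cthickening ε (box a b) = WithLp.ofLp ⁻¹' nearBox a b (ε ^ 2) := by
  rw [(isCompact_box a b).cthickening_eq_biUnion_closedBall hε]
  ext x
  simp only [Set.mem_iUnion, Metric.mem_closedBall, exists_prop, Set.mem_preimage, nearBox,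
    Set.mem_ofPred_eq]
  constructor
  · rintro ⟨y, hy, hxy⟩
    rw [EuclideanSpace.dist_eq, Real.sqrt_le_left hε] at hxy
    refine le_trans (Finset.sum_le_sum fun i _ => ?_) hxy
    have h := hy i
    refine pow_le_pow_left₀ (le_max_right _ _) ?_ 2
    rw [Real.dist_eq]
    refine max_le (max_le ?_ ?_) (abs_nonneg _)
    · have := neg_abs_le (x i - y i); linarith [h.1]
    · have := le_abs_self (x i - y i); linarith [h.2]
  · intro h
    -- The nearest point of the box is obtained by clamping each coordinate to its interval.
    refine ⟨WithLp.toLp 2 fun i => max (a i) (min (x i) (b i)), fun i => ?_, ?_⟩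
    · exact ⟨le_max_left _ _, max_le (hab i) (min_le_right _ _)⟩
    · rw [EuclideanSpace.dist_eq, Real.sqrt_le_left hε]
      refine le_trans (Finset.sum_le_sum fun i _ => ?_) h
      refine pow_le_pow_left₀ dist_nonneg ?_ 2
      have := hab i
      rw [Real.dist_eq]
      change |x i - max (a i) (min (x i) (b i))| ≤ gap (a i) (b i) (x i)
      rcases le_total (x i) (a i) with h1 | h1
      · rw [min_eq_left (h1.trans this), max_eq_left h1, abs_of_nonpos (by linarith),
          gap_of_le_left this h1]
        linarith
      · rcases le_total (x i) (b i) with h2 | h2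
        · rw [min_eq_left h2, max_eq_right h1, gap_of_mem h1 h2]
          simp
        · rw [min_eq_right h2, max_eq_right this, abs_of_nonneg (by linarith),
            gap_of_ge_right this h2]

lemma volume_cthickening_box {d : ℕ} {a b : Fin d → ℝ} (hab : ∀ i, a i ≤ b i) {ε : ℝ}
    (hε : 0 ≤ ε) :
    volume (Metric.cthickening ε (box a b)) = volume (nearBox a b (ε ^ 2)) := by
  rw [cthickening_box hab hε, (PiLp.volume_preserving_ofLp (Fin d)).measure_preimage
    (measurableSet_nearBox _ _ _).nullMeasurableSet]

/-- The degenerate box at the origin is a point, so its parallel set is a ball. -/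
lemma volume_nearBox_zero (m : ℕ) {ε : ℝ} (hε : 0 ≤ ε) :
    volume (nearBox (0 : Fin m → ℝ) 0 (ε ^ 2)) = ENNReal.ofReal (ε ^ m * ballVolume m) := by
  rw [← volume_cthickening_box (fun _ => le_rfl) hε]
  have h0 : box (0 : Fin m → ℝ) 0 = {(0 : E m)} := by
    ext x
    simp only [box, Set.mem_ofPred_eq, Set.mem_singleton_iff, Pi.zero_apply, Set.Icc_self]
    exact ⟨fun h => by ext i; exact h i, fun h i => by simp [h]⟩
  rw [h0, Metric.cthickening_singleton _ hε, Measure.addHaar_closedBall' _ _ hε,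
    ENNReal.ofReal_mul (by positivity), ballVolume,
    Measure.real, ENNReal.ofReal_toReal (isCompact_closedBall _ _).measure_lt_top.ne]
  simp

/-- This is the hypothesis of the Steiner clause of `IsIntrinsicVolume`, and so identifies the
intrinsic volumes of a box as the coefficients of `boxPoly`. -/
theorem steiner_box {d : ℕ} {a b : Fin d → ℝ} (hab : ∀ i, a i ≤ b i) {ε : ℝ} (hε : 0 ≤ ε) :
    volume.real (Metric.cthickening ε (box a b)) = ∑ j ∈ Finset.range (d + 1),
      ε ^ (d - j) * ballVolume (d - j) * (boxPoly fun i => b i - a i).coeff j := by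
  have hc := boxPoly_coeff_nonneg (l := fun i => b i - a i) (fun i => sub_nonneg.2 (hab i))
  rw [Measure.real, volume_cthickening_box hab hε, volume_nearBox a b hab, ENNReal.toReal_sum]
  · refine Finset.sum_congr rfl fun j _ => ?_
    rw [volume_nearBox_zero _ hε, ENNReal.toReal_mul, ENNReal.toReal_ofReal (hc j),
      ENNReal.toReal_ofReal (mul_nonneg (pow_nonneg hε _) (ballVolume_pos _).le)]
    ring
  · intro j _
    rw [volume_nearBox_zero _ hε]
    exact ENNReal.mul_ne_top ENNReal.ofReal_ne_top ENNReal.ofReal_ne_top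

end FractalPercolation

namespace FractalPercolation

/-! ### Intrinsic volumes of unions of boxes -/

lemma IsPolyconvex.union {d : ℕ} {K L : Set (E d)} (hK : IsPolyconvex K) (hL : IsPolyconvex L) :
    IsPolyconvex (K ∪ L) := by
  classical
  obtain ⟨s, hs, rfl⟩ := hK
  obtain ⟨t, ht, rfl⟩ := hL
  refine ⟨s ∪ t, fun C hC => ?_, by rw [Finset.set_biUnion_union]⟩
  exact (Finset.mem_union.1 hC).elim (hs C) (ht C)

lemma IsPolyconvex.inter {d : ℕ} {K L : Set (E d)} (hK : IsPolyconvex K) (hL : IsPolyconvex L) :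
    IsPolyconvex (K ∩ L) := by
  classical
  obtain ⟨s, hs, rfl⟩ := hK
  obtain ⟨t, ht, rfl⟩ := hL
  refine ⟨Finset.image₂ (· ∩ ·) s t, fun C hC => ?_, ?_⟩
  · obtain ⟨P, hP, Q, hQ, rfl⟩ := Finset.mem_image₂.1 hC
    exact ⟨(hs P hP).1.inter (ht Q hQ).1, (hs P hP).2.inter (ht Q hQ).2⟩
  · ext x
    simp only [Set.mem_inter_iff, Set.mem_iUnion, Finset.mem_image₂, exists_prop]
    constructor
    · rintro ⟨⟨P, hP, hx⟩, ⟨Q, hQ, hy⟩⟩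
      exact ⟨_, ⟨P, hP, Q, hQ, rfl⟩, hx, hy⟩
    · rintro ⟨_, ⟨P, hP, Q, hQ, rfl⟩, hx, hy⟩
      exact ⟨⟨P, hP, hx⟩, ⟨Q, hQ, hy⟩⟩

lemma isPolyconvex_empty (d : ℕ) : IsPolyconvex (∅ : Set (E d)) :=
  ⟨∅, by simp, by simp⟩

lemma isPolyconvex_box {d : ℕ} (a b : Fin d → ℝ) : IsPolyconvex (box a b) :=
  ⟨{box a b}, by simpa using ⟨isCompact_box a b, convex_box a b⟩, by simp⟩

lemma IsPolyconvex.biUnion {ι : Type*} {d : ℕ} {C : ι → Set (E d)} (s : Finset ι)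
    (h : ∀ i ∈ s, IsPolyconvex (C i)) : IsPolyconvex (⋃ i ∈ s, C i) := by
  classical
  induction s using Finset.induction_on with
  | empty => simpa using isPolyconvex_empty d
  | insert a s ha ih =>
    rw [Finset.set_biUnion_insert]
    exact (h a (Finset.mem_insert_self a s)).union
      (ih fun i hi => h i (Finset.mem_insert_of_mem hi))

variable {d : ℕ} {k : Fin (d + 1)}

lemma intrinsicVolume_empty : intrinsicVolume d k ∅ = 0 :=
  (isIntrinsicVolume_intrinsicVolume d k).steiner ∅ isCompact_empty convex_empty 0
    (fun ε _ => by simp)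

lemma intrinsicVolume_box {a b : Fin d → ℝ} (hab : ∀ i, a i ≤ b i) :
    intrinsicVolume d k (box a b) = (boxPoly fun i => b i - a i).coeff k :=
  (isIntrinsicVolume_intrinsicVolume d k).steiner _ (isCompact_box a b) (convex_box a b)
    (fun j => (boxPoly fun i => b i - a i).coeff j) fun _ hε => steiner_box hab hε

/-- Homogeneity of the coefficients reduces to sides at most `1`; an empty box has value `0`. -/
lemma abs_intrinsicVolume_box_le {a b : Fin d → ℝ} {ρ : ℝ} (hρ : 0 < ρ)
    (h : ∀ i, b i - a i ≤ ρ) : |intrinsicVolume d k (box a b)| ≤ 2 ^ d * ρ ^ (k : ℕ) := by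
  by_cases hab : ∀ i, a i ≤ b i
  · have h0 : ∀ i, 0 ≤ ρ⁻¹ * (b i - a i) :=
      fun i => mul_nonneg (inv_nonneg.2 hρ.le) (sub_nonneg.2 (hab i))
    have h1 : (boxPoly fun i => b i - a i).coeff k =
        ρ ^ (k : ℕ) * (boxPoly fun i => ρ⁻¹ * (b i - a i)).coeff k := by
      rw [← boxPoly_coeff_smul]
      congr 2
      ext i
      rw [mul_inv_cancel_left₀ hρ.ne']
    rw [intrinsicVolume_box hab, h1, abs_of_nonneg
      (mul_nonneg (pow_nonneg hρ.le _) (boxPoly_coeff_nonneg h0 _)), mul_comm]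
    refine mul_le_mul_of_nonneg_right (boxPoly_coeff_le h0 (fun i => ?_) _) (pow_nonneg hρ.le _)
    rw [inv_mul_le_iff₀ hρ, mul_one]
    exact h i
  · rw [box_eq_empty hab, intrinsicVolume_empty, abs_zero]
    positivity

/-- Induction from two-set additivity. The family `C` must vary, because the induction hypothesis is
used for both `C i` and `C a ∩ C i`. -/
theorem intrinsicVolume_biUnion {ι : Type*} (s : Finset ι) (C : ι → Set (E d))
    (h : ∀ i ∈ s, IsPolyconvex (C i)) :
    intrinsicVolume d k (⋃ i ∈ s, C i) =
      ∑ t ∈ s.powerset with t.Nonempty, (-1 : ℝ) ^ (t.card - 1) *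
        intrinsicVolume d k (⋂ i ∈ t, C i) := by
  classical
  -- Writing the sign as `-(-1)^|t|` and keeping a zero term for `t = ∅` avoids truncated
  -- subtraction and suits `Finset.sum_powerset_insert`.
  have key : ∀ (s : Finset ι) (C : ι → Set (E d)), (∀ i ∈ s, IsPolyconvex (C i)) →
      intrinsicVolume d k (⋃ i ∈ s, C i) = ∑ t ∈ s.powerset,
        if t.Nonempty then -(-1 : ℝ) ^ t.card * intrinsicVolume d k (⋂ i ∈ t, C i) else 0 := by
    intro s
    induction s using Finset.induction_on with
    | empty => intro C _; simp [intrinsicVolume_empty]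
    | insert a s ha ih =>
      intro C h
      have hCa := h a (Finset.mem_insert_self a s)
      have hC : ∀ i ∈ s, IsPolyconvex (C i) := fun i hi => h i (Finset.mem_insert_of_mem hi)
      have hadd := (isIntrinsicVolume_intrinsicVolume d k).additive _ _ hCa
        (IsPolyconvex.biUnion s hC)
      have hinter : C a ∩ ⋃ i ∈ s, C i = ⋃ i ∈ s, C a ∩ C i := by
        simp only [Set.inter_iUnion]
      rw [hinter, ih (fun i => C a ∩ C i) (fun i hi => hCa.inter (hC i hi)), ih C hC] at hadd
      rw [Finset.set_biUnion_insert, Finset.sum_powerset_insert ha]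
      have h2 : ∑ t ∈ s.powerset, (if (insert a t).Nonempty then -(-1 : ℝ) ^ (insert a t).card *
          intrinsicVolume d k (⋂ i ∈ insert a t, C i) else 0) =
          intrinsicVolume d k (C a) - ∑ t ∈ s.powerset,
            if t.Nonempty then -(-1 : ℝ) ^ t.card *
              intrinsicVolume d k (⋂ i ∈ t, C a ∩ C i) else 0 := by
        have h3 : intrinsicVolume d k (C a) = ∑ t ∈ s.powerset,
            if t = ∅ then intrinsicVolume d k (C a) else 0 := by
          rw [Finset.sum_ite_eq' s.powerset ∅, if_pos (Finset.empty_mem_powerset s)]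
        rw [h3, ← Finset.sum_sub_distrib]
        refine Finset.sum_congr rfl fun t ht => ?_
        have hat : a ∉ t := fun h => ha (Finset.mem_powerset.1 ht h)
        rw [if_pos (Finset.insert_nonempty a t), Finset.card_insert_of_notMem hat,
          Finset.set_biInter_insert]
        rcases t.eq_empty_or_nonempty with rfl | hne
        · simp
        · have h4 : C a ∩ ⋂ i ∈ t, C i = ⋂ i ∈ t, C a ∩ C i :=
            (Set.inter_biInter (s := (t : Set ι)) hne C (C a)).symm
          rw [if_pos hne, if_neg hne.ne_empty, h4, pow_succ]
          ring
      rw [h2]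
      linarith
  rw [key s C h, Finset.sum_filter]
  refine Finset.sum_congr rfl fun t _ => ?_
  split_ifs with hne
  · obtain ⟨m, hm⟩ := Nat.exists_eq_succ_of_ne_zero hne.card_pos.ne'
    rw [hm, Nat.succ_eq_add_one, Nat.add_sub_cancel, pow_succ]
    ring
  · rfl

lemma exists_biInter_eq_box {ι : Type*} {C : ι → Set (E d)} (hC : ∀ i, ∃ a b, C i = box a b)
    {t : Finset ι} (ht : t.Nonempty) : ∃ a b, ⋂ i ∈ t, C i = box a b := by
  classical
  induction ht using Finset.Nonempty.cons_induction with
  | singleton i => simpa using hC i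
  | cons i t hi _ ih =>
    obtain ⟨a, b, h⟩ := ih
    obtain ⟨a', b', h'⟩ := hC i
    refine ⟨a' ⊔ a, b' ⊓ b, ?_⟩
    rw [Finset.cons_eq_insert, Finset.set_biInter_insert, h, h', box_inter]

/-- In inclusion–exclusion only sets `t` with a common point count, and such a `t` lies in `N i` for
any `i ∈ t`. This leaves at most `2^B` sets per index, so the bound is linear in the number of
pieces. -/
lemma abs_intrinsicVolume_biUnion_le {ι : Type*} [DecidableEq ι] (s : Finset ι)
    (C : ι → Set (E d)) (h : ∀ i ∈ s, IsPolyconvex (C i)) {R : ℝ}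
    (hR : ∀ t ⊆ s, t.Nonempty → |intrinsicVolume d k (⋂ i ∈ t, C i)| ≤ R)
    {B : ℕ} (N : ι → Finset ι) (hN : ∀ i ∈ s, ∀ j ∈ s, (C i ∩ C j).Nonempty → j ∈ N i)
    (hB : ∀ i ∈ s, (N i).card ≤ B) :
    |intrinsicVolume d k (⋃ i ∈ s, C i)| ≤ s.card * (2 ^ B * R) := by
  classical
  rcases s.eq_empty_or_nonempty with rfl | ⟨i₀, hi₀⟩
  · simp [intrinsicVolume_empty]
  have hR0 : 0 ≤ R := (abs_nonneg _).trans
    (hR {i₀} (Finset.singleton_subset_iff.2 hi₀) (Finset.singleton_nonempty _))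
  rw [intrinsicVolume_biUnion s C h]
  let Q := {t ∈ s.powerset | t.Nonempty}
  have hQ : ∀ t ∈ Q, |(-1 : ℝ) ^ (t.card - 1) * intrinsicVolume d k (⋂ i ∈ t, C i)| ≤
      if (⋂ i ∈ t, C i).Nonempty then R else 0 := by
    intro t ht
    rw [abs_mul, abs_pow, abs_neg, abs_one, one_pow, one_mul]
    split_ifs with hne
    · exact hR t (Finset.mem_powerset.1 (Finset.mem_filter.1 ht).1) (Finset.mem_filter.1 ht).2
    · rw [Set.not_nonempty_iff_eq_empty.1 hne, intrinsicVolume_empty, abs_zero]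
  refine (Finset.abs_sum_le_sum_abs _ _).trans ((Finset.sum_le_sum hQ).trans ?_)
  rw [← Finset.sum_filter, Finset.sum_const, nsmul_eq_mul, ← mul_assoc]
  refine mul_le_mul_of_nonneg_right ?_ hR0
  have hsub : {t ∈ Q | (⋂ i ∈ t, C i).Nonempty} ⊆ s.biUnion fun i => (N i).powerset := by
    intro t ht
    obtain ⟨ht, x, hx⟩ := Finset.mem_filter.1 ht
    obtain ⟨hts, i, hi⟩ := Finset.mem_filter.1 ht
    have hts := Finset.mem_powerset.1 hts
    have hx := Set.mem_iInter₂.1 hx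
    refine Finset.mem_biUnion.2 ⟨i, hts hi, Finset.mem_powerset.2 fun j hj => ?_⟩
    exact hN i (hts hi) j (hts hj) ⟨x, hx i hi, hx j hj⟩
  have hcard : ({t ∈ Q | (⋂ i ∈ t, C i).Nonempty}).card ≤ s.card * 2 ^ B := by
    refine (Finset.card_le_card hsub).trans (Finset.card_biUnion_le.trans ?_)
    rw [← smul_eq_mul, ← Finset.sum_const]
    refine Finset.sum_le_sum fun i hi => ?_
    rw [Finset.card_powerset]
    exact Nat.pow_le_pow_right two_pos (hB i hi)
  exact_mod_cast hcard

/-! ### Scaling under the similarities -/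

variable {M : ℕ}

lemma phi_injective (hM : 0 < M) (j : Letter d M) : Function.Injective (phi j) := by
  intro x y h
  have hM' : (M : ℝ) ≠ 0 := by exact_mod_cast hM.ne'
  ext i
  have : (x i + ((j i : ℕ) : ℝ)) / (M : ℝ) = (y i + ((j i : ℕ) : ℝ)) / (M : ℝ) :=
    congrArg (fun z : E d => z i) h
  rw [div_left_inj' hM'] at this
  linarith

lemma phi_image_box (hM : 0 < M) (j : Letter d M) (a b : Fin d → ℝ) :
    phi j '' box a b = box (fun i => (a i + ((j i : ℕ) : ℝ)) / M)
      (fun i => (b i + ((j i : ℕ) : ℝ)) / M) := by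
  have hM' : (0 : ℝ) < M := by exact_mod_cast hM
  ext y
  constructor
  · rintro ⟨x, hx, rfl⟩ i
    obtain ⟨h1, h2⟩ := hx i
    exact ⟨div_le_div_of_nonneg_right (by linarith) hM'.le,
      div_le_div_of_nonneg_right (by linarith) hM'.le⟩
  · intro hy
    refine ⟨WithLp.toLp 2 fun i => y i * M - ((j i : ℕ) : ℝ), fun i => ?_, ?_⟩
    · obtain ⟨h1, h2⟩ := hy i
      rw [div_le_iff₀ hM'] at h1
      rw [le_div_iff₀ hM'] at h2
      exact ⟨by simpa using by linarith, by simpa using by linarith⟩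
    · ext i
      simp [phi, hM'.ne']

lemma intrinsicVolume_phi_image_box (hM : 0 < M) (j : Letter d M) (a b : Fin d → ℝ) :
    intrinsicVolume d k (phi j '' box a b) =
      (1 / (M : ℝ)) ^ (k : ℕ) * intrinsicVolume d k (box a b) := by
  have hM' : (0 : ℝ) < M := by exact_mod_cast hM
  by_cases hab : ∀ i, a i ≤ b i
  · rw [phi_image_box hM, intrinsicVolume_box hab, intrinsicVolume_box, ← boxPoly_coeff_smul]
    · congr 2
      ext i
      ring
    · intro i
      exact div_le_div_of_nonneg_right (by linarith [hab i]) hM'.le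
  · rw [box_eq_empty hab, Set.image_empty, intrinsicVolume_empty, mul_zero]

/-- Injectivity of `phi j` lets images commute with intersections, so inclusion–exclusion carries
homogeneity from boxes to their finite unions. -/
lemma intrinsicVolume_phi_image (hM : 0 < M) (j : Letter d M) {ι : Type*} (s : Finset ι)
    {C : ι → Set (E d)} (hC : ∀ i, ∃ a b, C i = box a b) :
    intrinsicVolume d k (phi j '' ⋃ i ∈ s, C i) =
      (1 / (M : ℝ)) ^ (k : ℕ) * intrinsicVolume d k (⋃ i ∈ s, C i) := by
  have h1 : ∀ i ∈ s, IsPolyconvex (C i) := by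
    intro i _
    obtain ⟨a, b, h⟩ := hC i
    exact h ▸ isPolyconvex_box a b
  have h2 : ∀ i ∈ s, IsPolyconvex (phi j '' C i) := by
    intro i _
    obtain ⟨a, b, h⟩ := hC i
    rw [h, phi_image_box hM]
    exact isPolyconvex_box _ _
  rw [Set.image_iUnion₂, intrinsicVolume_biUnion s _ h1, intrinsicVolume_biUnion s _ h2,
    Finset.mul_sum]
  refine Finset.sum_congr rfl fun t ht => ?_
  have hne := (Finset.mem_filter.1 ht).2
  obtain ⟨a, b, hab⟩ := exists_biInter_eq_box hC hne
  rw [← Set.InjOn.image_biInter_eq hne (phi_injective hM j).injOn, hab,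
    intrinsicVolume_phi_image_box hM]
  ring

end FractalPercolation

namespace FractalPercolation

/-! ### Words and cubes -/

variable {d M : ℕ}

/-- The position of the cube `J_σ` in the grid of mesh `M ^ (-n)`, `n` the length of `σ`. -/
def pos : List (Letter d M) → Fin d → ℕ
  | [] => 0
  | j :: σ => fun i => (j i : ℕ) * M ^ σ.length + pos σ i

lemma pos_lt (σ : List (Letter d M)) (i : Fin d) : pos σ i < M ^ σ.length := by
  induction σ with
  | nil => simp [pos]
  | cons j σ ih =>
    have h : ((j i : ℕ) + 1) * M ^ σ.length ≤ M * M ^ σ.length := Nat.mul_le_mul_right _ (j i).2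
    rw [List.length_cons, pow_succ', pos]
    linarith

/-- Each coordinate of `pos σ` is a base-`M` expansion whose digits come from the letters of `σ`.
The tail is below `M^n`, so the leading digit can be recovered. -/
lemma pos_injOn (n : ℕ) : Set.InjOn (pos (d := d) (M := M)) {σ | σ.length = n} := by
  intro σ hσ τ hτ h
  induction n generalizing σ τ with
  | zero => rw [List.length_eq_zero_iff.1 hσ, List.length_eq_zero_iff.1 hτ]
  | succ n ih =>
    obtain ⟨j, σ, rfl⟩ := List.exists_cons_of_length_eq_add_one hσ
    obtain ⟨l, τ, rfl⟩ := List.exists_cons_of_length_eq_add_one hτ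
    have hσ : σ.length = n := by simpa using hσ
    have hτ : τ.length = n := by simpa using hτ
    have key : ∀ i, j i = l i ∧ pos σ i = pos τ i := by
      intro i
      have h1 : (j i : ℕ) * M ^ σ.length + pos σ i = (l i : ℕ) * M ^ τ.length + pos τ i :=
        congrFun h i
      have h2 := pos_lt σ i
      have h3 := pos_lt τ i
      rw [hσ] at h1 h2
      rw [hτ] at h1 h3
      have h4 : (j i : ℕ) = l i := by
        rcases lt_trichotomy (j i : ℕ) (l i) with h | h | h
        · have := Nat.mul_le_mul_right (M ^ n) (Nat.succ_le_of_lt h)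
          rw [Nat.succ_mul] at this
          omega
        · exact h
        · have := Nat.mul_le_mul_right (M ^ n) (Nat.succ_le_of_lt h)
          rw [Nat.succ_mul] at this
          omega
      refine ⟨Fin.ext h4, ?_⟩
      rw [h4] at h1
      omega
    rw [funext fun i => (key i).1, ih hσ hτ (funext fun i => (key i).2)]

lemma cube_eq_box (hM : 0 < M) (σ : List (Letter d M)) :
    cube σ = box (fun i => (pos σ i : ℝ) / M ^ σ.length)
      (fun i => ((pos σ i : ℝ) + 1) / M ^ σ.length) := by
  have hM' : (M : ℝ) ≠ 0 := by exact_mod_cast hM.ne'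
  induction σ with
  | nil => simp [cube, pos, box, unitCube]
  | cons j σ ih =>
    rw [cube, ih, phi_image_box hM]
    congr 1
    all_goals
      ext i
      simp only [pos, List.length_cons]
      push_cast
      field_simp
      try ring

lemma exists_cube_eq_box (hM : 0 < M) (σ : List (Letter d M)) : ∃ a b, cube σ = box a b :=
  ⟨_, _, cube_eq_box hM σ⟩

lemma pos_le_of_cube_inter (hM : 0 < M) {n : ℕ} {σ τ : List (Letter d M)} (hσ : σ.length = n)
    (hτ : τ.length = n) (h : (cube σ ∩ cube τ).Nonempty) (i : Fin d) :
    pos τ i ≤ pos σ i + 1 := by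
  obtain ⟨x, h1, h2⟩ := h
  rw [cube_eq_box hM] at h1 h2
  have h1 := (h1 i).2
  have h2 := (h2 i).1
  rw [hσ] at h1
  rw [hτ] at h2
  have hM' : (0 : ℝ) < M ^ n := by positivity
  have h3 := h2.trans h1
  rw [div_le_div_iff_of_pos_right hM'] at h3
  exact_mod_cast h3

/-- The words of length `n`. -/
noncomputable def words (d M n : ℕ) : Finset (List (Letter d M)) :=
  (List.finite_length_eq (Letter d M) n).toFinset

lemma mem_words {n : ℕ} {σ : List (Letter d M)} : σ ∈ words d M n ↔ σ.length = n := by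
  simp [words]

open Classical in
/-- The words `τ` of length `n` whose cubes meet the cube of `σ`. -/
noncomputable def neighbours (n : ℕ) (σ : List (Letter d M)) : Finset (List (Letter d M)) :=
  {τ ∈ words d M n | (cube σ ∩ cube τ).Nonempty}

lemma mem_neighbours {n : ℕ} {σ τ : List (Letter d M)} :
    τ ∈ neighbours n σ ↔ τ.length = n ∧ (cube σ ∩ cube τ).Nonempty := by
  simp [neighbours, mem_words]

lemma card_neighbours_le (hM : 0 < M) {n : ℕ} {σ : List (Letter d M)} (hσ : σ.length = n) :
    (neighbours n σ).card ≤ 3 ^ d := by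
  classical
  have h1 : ∀ τ ∈ neighbours n σ,
      pos τ ∈ Fintype.piFinset fun i => Finset.Icc (pos σ i - 1) (pos σ i + 1) := by
    intro τ hτ
    obtain ⟨hτ, h⟩ := mem_neighbours.1 hτ
    refine Fintype.mem_piFinset.2 fun i => Finset.mem_Icc.2 ⟨?_, pos_le_of_cube_inter hM hσ hτ h i⟩
    have := pos_le_of_cube_inter hM hτ hσ (Set.inter_comm _ _ ▸ h) i
    omega
  have h2 := Finset.card_le_card_of_injOn pos h1
    ((pos_injOn n).mono fun τ hτ => (mem_neighbours.1 hτ).1)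
  refine h2.trans ?_
  rw [Fintype.card_piFinset]
  calc _ ≤ ∏ _i : Fin d, 3 := Finset.prod_le_prod' fun i _ => by rw [Nat.card_Icc]; omega
    _ = 3 ^ d := by simp

open Classical in
/-- The words of length `n` with first letter `j` whose cubes meet some cube of the same level
with first letter `l`. -/
noncomputable def boundaryWords (j l : Letter d M) (n : ℕ) : Finset (List (Letter d M)) :=
  {σ ∈ words d M n | σ.head? = some j ∧ ∃ τ : List (Letter d M), τ.length = n ∧
    τ.head? = some l ∧ (cube σ ∩ cube τ).Nonempty}

/-- In a coordinate where `j` and `l` differ, a cube of `J_j` touching one of `J_l` lies in an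
extreme layer of `J_j`. The resulting exponent `d - 1` in place of `d` is what makes the series
converge. -/
lemma card_boundaryWords_le (hM : 0 < M) {j l : Letter d M} (hjl : j ≠ l) (n : ℕ) :
    (boundaryWords j l (n + 1)).card ≤ 2 * (M ^ (n + 1)) ^ (d - 1) := by
  classical
  obtain ⟨i, hi⟩ := Function.ne_iff.1 hjl
  -- The two values in direction `i` are the first and last grid positions inside `J_j`.
  let S : Fin d → Finset ℕ := Function.update (fun _ => Finset.range (M ^ (n + 1))) i
    {(j i : ℕ) * M ^ n, ((j i : ℕ) + 1) * M ^ n - 1}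
  have h1 : ∀ σ ∈ boundaryWords j l (n + 1), pos σ ∈ Fintype.piFinset S := by
    intro σ hσb
    obtain ⟨hmem, hj, τ, hτ, hl, hne⟩ := Finset.mem_filter.1 hσb
    have hσ := mem_words.1 hmem
    refine Fintype.mem_piFinset.2 fun m => ?_
    by_cases hm : m = i
    · subst hm
      simp only [S, Function.update_self, Finset.mem_insert, Finset.mem_singleton]
      have h2 := pos_le_of_cube_inter hM hσ hτ hne m
      have h3 := pos_le_of_cube_inter hM hτ hσ (Set.inter_comm _ _ ▸ hne) m
      obtain ⟨j', σ, rfl⟩ := List.exists_cons_of_length_eq_add_one hσ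
      obtain ⟨l', τ, rfl⟩ := List.exists_cons_of_length_eq_add_one hτ
      obtain rfl : j' = j := by simpa using hj
      obtain rfl : l' = l := by simpa using hl
      replace hσ : σ.length = n := by simpa using hσ
      replace hτ : τ.length = n := by simpa using hτ
      have h4 := pos_lt σ m
      have h5 := pos_lt τ m
      simp only [pos] at h2 h3 ⊢
      rw [hσ] at h2 h3 h4 ⊢
      rw [hτ] at h2 h3 h5
      have hne : (j' m : ℕ) ≠ l' m := fun h => hi (Fin.ext h)
      rw [Nat.succ_mul]
      rcases lt_or_gt_of_ne hne with h | h
      · right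
        have := Nat.mul_le_mul_right (M ^ n) (Nat.succ_le_of_lt h)
        rw [Nat.succ_mul] at this
        omega
      · left
        have := Nat.mul_le_mul_right (M ^ n) (Nat.succ_le_of_lt h)
        rw [Nat.succ_mul] at this
        omega
    · simp only [S, Function.update_of_ne hm, Finset.mem_range]
      exact hσ ▸ pos_lt σ m
  have h2 := Finset.card_le_card_of_injOn pos h1
    ((pos_injOn (n + 1)).mono fun σ hσ => mem_words.1 (Finset.mem_filter.1 hσ).1)
  refine h2.trans ?_
  rw [Fintype.card_piFinset, ← Finset.mul_prod_erase _ _ (Finset.mem_univ i)]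
  refine Nat.mul_le_mul ?_ ?_
  · simp only [S, Function.update_self]
    exact Finset.card_le_two
  · rw [Finset.prod_congr rfl (g := fun _ => M ^ (n + 1))]
    · rw [Finset.prod_const, Finset.card_erase_of_mem (Finset.mem_univ i), Finset.card_univ,
        Fintype.card_fin]
    · intro m hm
      simp [S, Function.update_of_ne (Finset.ne_of_mem_erase hm)]

/-! ### The random tree -/

variable {Ω : Type*} {I : List (Letter d M) → Ω → Set (Letter d M)} {ω : Ω}

lemma length_of_mem_tree {n : ℕ} {σ : List (Letter d M)} (h : σ ∈ tree I ω n) :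
    σ.length = n := by
  induction n generalizing σ with
  | zero => rw [tree, Set.mem_singleton_iff] at h; simp [h]
  | succ n ih =>
    obtain ⟨τ, hτ, j, _, rfl⟩ := h
    simp [ih hτ]

/-- The tree grows by appending last letters, whereas self-similarity strips the first one; this
reconciles the two. -/
lemma cons_mem_tree {n : ℕ} {j : Letter d M} {σ : List (Letter d M)} :
    j :: σ ∈ tree I ω (n + 1) ↔ j ∈ I [] ω ∧ σ ∈ tree (fun τ => I (j :: τ)) ω n := by
  induction n generalizing σ with
  | zero =>
    constructor
    · rintro ⟨τ, hτ, l, hl, h⟩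
      obtain rfl : τ = [] := hτ
      rw [List.nil_append, List.cons.injEq] at h
      obtain ⟨rfl, rfl⟩ := h
      exact ⟨hl, rfl⟩
    · rintro ⟨hj, hσ⟩
      obtain rfl : σ = [] := hσ
      exact ⟨[], rfl, j, hj, rfl⟩
  | succ n ih =>
    constructor
    · rintro ⟨τ, hτ, l, hl, h⟩
      obtain ⟨j', τ, rfl⟩ := List.exists_cons_of_length_eq_add_one (length_of_mem_tree hτ)
      rw [List.cons_append, List.cons.injEq] at h
      obtain ⟨rfl, rfl⟩ := h
      obtain ⟨hj, hτ⟩ := ih.1 hτ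
      exact ⟨hj, τ, hτ, l, hl, rfl⟩
    · rintro ⟨hj, τ, hτ, l, hl, rfl⟩
      exact ⟨j :: τ, ih.2 ⟨hj, hτ⟩, l, hl, rfl⟩

/-- The decisions on which the survival of the word `σ` depends. -/
def edges : List (Letter d M) → Finset (List (Letter d M) × Letter d M)
  | [] => ∅
  | j :: σ => insert ([], j) ((edges σ).image fun q => (j :: q.1, q.2))

lemma mem_tree_iff {n : ℕ} {σ : List (Letter d M)} :
    σ ∈ tree I ω n ↔ σ.length = n ∧ ∀ q ∈ edges σ, q.2 ∈ I q.1 ω := by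
  induction n generalizing σ I with
  | zero =>
    rw [tree, Set.mem_singleton_iff]
    constructor
    · rintro rfl
      simp [edges]
    · exact fun h => List.length_eq_zero_iff.1 h.1
  | succ n ih =>
    rcases σ with _ | ⟨j, σ⟩
    · constructor
      · intro h
        simpa using length_of_mem_tree h
      · intro h
        simpa using h.1
    · rw [cons_mem_tree, ih]
      simp only [edges, List.length_cons, add_left_inj, Finset.forall_mem_insert,
        Finset.forall_mem_image]
      tauto

lemma card_edges (σ : List (Letter d M)) : (edges σ).card = σ.length := by
  induction σ with
  | nil => rfl
  | cons j σ ih =>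
    rw [edges, Finset.card_insert_of_notMem, Finset.card_image_of_injective, ih, List.length_cons]
    · intro q q' h
      simpa [Prod.ext_iff] using h
    · simp

/-- Words that branch at the root depend on disjoint sets of decisions, so their survivals are
independent. -/
lemma disjoint_edges {j l : Letter d M} (h : j ≠ l) (σ τ : List (Letter d M)) :
    Disjoint (edges (j :: σ)) (edges (l :: τ)) := by
  rw [Finset.disjoint_left]
  simp only [edges, Finset.mem_insert, Finset.mem_image, not_or]
  rintro q (rfl | ⟨q, _, rfl⟩)
  · simp [h]
  · simp [h.symm]

lemma step_eq_biUnion (n : ℕ) (A : Finset (List (Letter d M))) (hA : ↑A = tree I ω n) :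
    step I n ω = ⋃ σ ∈ A, cube σ := by
  rw [step, ← hA]
  rfl

lemma finite_tree (n : ℕ) : (tree I ω n).Finite :=
  (List.finite_length_eq (Letter d M) n).subset fun _ h => length_of_mem_tree h

lemma stepPart_succ (j : Letter d M) (n : ℕ) [Decidable (j ∈ I [] ω)] :
    stepPart I j (n + 1) ω =
      if j ∈ I [] ω then phi j '' step (fun σ => I (j :: σ)) n ω else ∅ := by
  have h : ∀ τ, τ ∈ {τ ∈ tree I ω (n + 1) | τ.head? = some j} ↔
      ∃ σ, τ = j :: σ ∧ j ∈ I [] ω ∧ σ ∈ tree (fun τ => I (j :: τ)) ω n := by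
    intro τ
    constructor
    · rintro ⟨hτ, hj⟩
      obtain ⟨l, τ, rfl⟩ := List.exists_cons_of_length_eq_add_one (length_of_mem_tree hτ)
      obtain rfl : l = j := by simpa using hj
      exact ⟨τ, rfl, cons_mem_tree.1 hτ⟩
    · rintro ⟨σ, rfl, h⟩
      exact ⟨cons_mem_tree.2 h, rfl⟩
  ext x
  simp only [stepPart, Set.mem_iUnion, exists_prop, h]
  split_ifs with hj
  · rw [step, Set.image_iUnion₂]
    simp only [Set.mem_iUnion, exists_prop]
    constructor
    · rintro ⟨_, ⟨σ, rfl, _, hσ⟩, hx⟩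
      exact ⟨σ, hσ, hx⟩
    · rintro ⟨σ, hσ, hx⟩
      exact ⟨_, ⟨σ, rfl, hj, hσ⟩, hx⟩
  · simp only [Set.mem_empty_iff_false, iff_false]
    rintro ⟨_, ⟨σ, rfl, hj', _⟩, _⟩
    exact hj hj'

lemma step_succ (n : ℕ) : step I (n + 1) ω = ⋃ j : Letter d M, stepPart I j (n + 1) ω := by
  ext x
  simp only [step, stepPart, Set.mem_iUnion, exists_prop]
  constructor
  · rintro ⟨σ, hσ, hx⟩
    obtain ⟨l, τ, rfl⟩ := List.exists_cons_of_length_eq_add_one (length_of_mem_tree hσ)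
    exact ⟨l, _, ⟨hσ, rfl⟩, hx⟩
  · rintro ⟨j, σ, hσ, hx⟩
    exact ⟨σ, hσ.1, hx⟩

lemma isPolyconvex_cube (hM : 0 < M) (σ : List (Letter d M)) : IsPolyconvex (cube σ) :=
  cube_eq_box hM σ ▸ isPolyconvex_box _ _

lemma isPolyconvex_stepPart (hM : 0 < M) (j : Letter d M) (n : ℕ) :
    IsPolyconvex (stepPart I j n ω) := by
  have hfin : {τ ∈ tree I ω n | τ.head? = some j}.Finite :=
    (finite_tree n).subset fun _ h => h.1
  have h := IsPolyconvex.biUnion hfin.toFinset fun σ _ => isPolyconvex_cube hM σ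
  simp only [hfin.mem_toFinset] at h
  exact h

end FractalPercolation

namespace FractalPercolation

/-! ### Expectations of functionals of the random tree -/

variable {d M : ℕ} {Ω : Type*} [MeasurableSpace Ω] {μ : Measure Ω}
  {I : List (Letter d M) → Ω → Set (Letter d M)} {p : ℝ}

lemma measurableSet_mem_tree (hI : ∀ σ j, MeasurableSet {ω | j ∈ I σ ω}) (n : ℕ)
    (σ : List (Letter d M)) : MeasurableSet {ω | σ ∈ tree I ω n} := by
  have h : {ω | σ ∈ tree I ω n} =
      {_ω | σ.length = n} ∩ ⋂ q ∈ edges σ, {ω | q.2 ∈ I q.1 ω} := by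
    ext ω
    simp [mem_tree_iff]
  rw [h]
  exact (MeasurableSet.const _).inter (Finset.measurableSet_biInter _ fun q _ => hI _ _)

/-- The tree at level `n` is a finite set of words, hence a random variable with countably many
values. No regularity of `h`, in particular of `V_k`, is needed. -/
lemma measurable_comp_tree (hI : ∀ σ j, MeasurableSet {ω | j ∈ I σ ω}) (n : ℕ)
    (h : Set (List (Letter d M)) → ℝ) : Measurable fun ω => h (tree I ω n) := by
  let _ : MeasurableSpace (Finset (List (Letter d M))) := ⊤
  have h1 : Measurable fun ω => (finite_tree (I := I) (ω := ω) n).toFinset := by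
    refine measurable_to_countable' fun A => ?_
    have : (fun ω => (finite_tree (I := I) (ω := ω) n).toFinset) ⁻¹' {A} =
        ⋂ σ, {ω | σ ∈ tree I ω n ↔ σ ∈ A} := by
      ext ω
      simp [Finset.ext_iff]
    rw [this]
    exact MeasurableSet.iInter fun σ =>
      (measurableSet_mem_tree hI n σ).iff (MeasurableSet.const _)
  have h2 : Measurable fun A : Finset (List (Letter d M)) => h ↑A := measurable_from_top
  simpa [Function.comp_def] using h2.comp h1

lemma exists_bound_comp_tree {Ω : Type*} (I : List (Letter d M) → Ω → Set (Letter d M)) (n : ℕ)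
    (h : Set (List (Letter d M)) → ℝ) : ∃ C, ∀ ω, |h (tree I ω n)| ≤ C := by
  refine ⟨∑ A ∈ (words d M n).powerset, |h ↑A|, fun ω => ?_⟩
  have hf := finite_tree (I := I) (ω := ω) n
  have hA : hf.toFinset ∈ (words d M n).powerset := by
    refine Finset.mem_powerset.2 fun σ hσ => mem_words.2 ?_
    exact length_of_mem_tree (hf.mem_toFinset.1 hσ)
  have := Finset.single_le_sum (f := fun A : Finset (List (Letter d M)) => |h ↑A|)
    (fun _ _ => abs_nonneg _) hA
  simpa using this

lemma integrable_comp_tree [IsFiniteMeasure μ] (hI : ∀ σ j, MeasurableSet {ω | j ∈ I σ ω}) (n : ℕ)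
    (h : Set (List (Letter d M)) → ℝ) : Integrable (fun ω => h (tree I ω n)) μ := by
  obtain ⟨C, hC⟩ := exists_bound_comp_tree I n h
  exact Integrable.of_bound (measurable_comp_tree hI n h).aestronglyMeasurable C
    (Eventually.of_forall hC)

/-! ### The law of the percolation and its self-similarity -/

lemma IsFractalPercolation.measurable_mem (hI : IsFractalPercolation μ p I)
    (q : List (Letter d M) × Letter d M) : Measurable fun ω => q.2 ∈ I q.1 ω :=
  measurableSet_setOfPred.1 (hI.measurableSet q.1 q.2)

/-- Independence makes both laws infinite products, and each two-valued factor is determined by `p`.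
-/
lemma IsFractalPercolation.map_eq {Ω' : Type*} [MeasurableSpace Ω'] {μ' : Measure Ω'}
    [IsProbabilityMeasure μ] [IsProbabilityMeasure μ']
    {I' : List (Letter d M) → Ω' → Set (Letter d M)}
    (hI : IsFractalPercolation μ p I) (hI' : IsFractalPercolation μ' p I') :
    μ.map (fun ω (q : List (Letter d M) × Letter d M) => q.2 ∈ I q.1 ω) =
      μ'.map (fun ω (q : List (Letter d M) × Letter d M) => q.2 ∈ I' q.1 ω) := by
  have h1 : iIndepFun (fun (q : List (Letter d M) × Letter d M) ω => q.2 ∈ I q.1 ω) μ := by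
    have := hI.indep
    rw [iIndepSet_iff_iIndep] at this
    simp only [MeasurableSpace.generateFrom_singleton] at this
    exact this
  have h2 : iIndepFun (fun (q : List (Letter d M) × Letter d M) ω => q.2 ∈ I' q.1 ω) μ' := by
    have := hI'.indep
    rw [iIndepSet_iff_iIndep] at this
    simp only [MeasurableSpace.generateFrom_singleton] at this
    exact this
  rw [(iIndepFun_iff_map_fun_eq_infinitePi_map hI.measurable_mem).1 h1,
    (iIndepFun_iff_map_fun_eq_infinitePi_map hI'.measurable_mem).1 h2]
  congr 1
  ext1 q
  have htrue : μ {ω | q.2 ∈ I q.1 ω} = μ' {ω | q.2 ∈ I' q.1 ω} := by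
    rw [← measureReal_eq_measureReal_iff, hI.prob, hI'.prob]
  refine Measure.ext_of_singleton fun a => ?_
  rw [Measure.map_apply (hI.measurable_mem q) (measurableSet_singleton a),
    Measure.map_apply (hI'.measurable_mem q) (measurableSet_singleton a)]
  by_cases ha : a
  · convert htrue using 2 <;> ext ω <;> simp [ha]
  · have h3 := prob_compl_eq_one_sub (μ := μ) (hI.measurableSet q.1 q.2)
    have h4 := prob_compl_eq_one_sub (μ := μ') (hI'.measurableSet q.1 q.2)
    rw [htrue, ← h4] at h3
    convert h3 using 2 <;> ext ω <;> simp [ha]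

/-- The subdivision rule on the space of all families of decisions. -/
def coordRule (d M : ℕ) (σ : List (Letter d M)) (y : List (Letter d M) × Letter d M → Prop) :
    Set (Letter d M) :=
  {j | y (σ, j)}

lemma measurableSet_mem_coordRule (σ : List (Letter d M)) (j : Letter d M) :
    MeasurableSet {y | j ∈ coordRule d M σ y} :=
  measurableSet_setOfPred.2 (measurable_pi_apply (σ, j))

lemma tree_coordRule {Ω : Type*} (I : List (Letter d M) → Ω → Set (Letter d M)) (ω : Ω) (n : ℕ) :
    tree (coordRule d M) (fun q => q.2 ∈ I q.1 ω) n = tree I ω n := by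
  ext σ
  rw [mem_tree_iff, mem_tree_iff]
  rfl

lemma IsFractalPercolation.integral_comp_tree (hI : IsFractalPercolation μ p I) (n : ℕ)
    (h : Set (List (Letter d M)) → ℝ) :
    ∫ ω, h (tree I ω n) ∂μ = ∫ y, h (tree (coordRule d M) y n)
      ∂(μ.map fun ω (q : List (Letter d M) × Letter d M) => q.2 ∈ I q.1 ω) := by
  rw [integral_map (measurable_pi_lambda _ hI.measurable_mem).aemeasurable
    (measurable_comp_tree measurableSet_mem_coordRule n h).aestronglyMeasurable]
  simp only [tree_coordRule]

lemma IsFractalPercolation.integral_tree_eq {Ω' : Type*} [MeasurableSpace Ω'] {μ' : Measure Ω'}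
    [IsProbabilityMeasure μ] [IsProbabilityMeasure μ']
    {I' : List (Letter d M) → Ω' → Set (Letter d M)}
    (hI : IsFractalPercolation μ p I) (hI' : IsFractalPercolation μ' p I') (n : ℕ)
    (h : Set (List (Letter d M)) → ℝ) :
    ∫ ω, h (tree I ω n) ∂μ = ∫ ω, h (tree I' ω n) ∂μ' := by
  rw [hI.integral_comp_tree, hI'.integral_comp_tree, hI.map_eq hI']

lemma IsFractalPercolation.measureReal_biInter (hI : IsFractalPercolation μ p I)
    (S : Finset (List (Letter d M) × Letter d M)) :
    μ.real (⋂ q ∈ S, {ω | q.2 ∈ I q.1 ω}) = p ^ S.card := by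
  rw [Measure.real, hI.indep.meas_biInter S, ENNReal.toReal_prod, ← Finset.prod_const]
  exact Finset.prod_congr rfl fun q _ => hI.prob q.1 q.2

lemma IsFractalPercolation.measureReal_mem_tree_and (hI : IsFractalPercolation μ p I) {n : ℕ}
    {σ τ : List (Letter d M)} (hσ : σ.length = n) (hτ : τ.length = n) {j l : Letter d M}
    (hj : σ.head? = some j) (hl : τ.head? = some l) (hjl : j ≠ l) :
    μ.real ({ω | σ ∈ tree I ω n} ∩ {ω | τ ∈ tree I ω n}) = p ^ (2 * n) := by
  classical
  have h1 : {ω | σ ∈ tree I ω n} ∩ {ω | τ ∈ tree I ω n} =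
      ⋂ q ∈ edges σ ∪ edges τ, {ω | q.2 ∈ I q.1 ω} := by
    ext ω
    simp only [mem_tree_iff, hσ, hτ, true_and, Set.mem_ofPred_eq, Set.mem_inter_iff, Set.mem_iInter,
      Finset.forall_mem_union]
  obtain ⟨σ, rfl⟩ : ∃ σ', σ = j :: σ' := by cases σ <;> simp_all
  obtain ⟨τ, rfl⟩ : ∃ τ', τ = l :: τ' := by cases τ <;> simp_all
  rw [h1, hI.measureReal_biInter, Finset.card_union_of_disjoint (disjoint_edges hjl σ τ),
    card_edges, card_edges, hσ, hτ, two_mul]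

/-- The decision at the root about `j` is independent of all decisions below `j`, so conditioning on
it leaves their joint law unchanged. -/
lemma IsFractalPercolation.cond [IsProbabilityMeasure μ] (hI : IsFractalPercolation μ p I)
    (hp : 0 < p) (j : Letter d M) :
    IsFractalPercolation (ProbabilityTheory.cond μ {ω | j ∈ I [] ω}) p (fun σ => I (j :: σ)) := by
  classical
  set A : Set Ω := {ω | j ∈ I [] ω} with hAdef
  let B : List (Letter d M) × Letter d M → Set Ω := fun q => {ω | q.2 ∈ I q.1 ω}
  let f : List (Letter d M) × Letter d M → List (Letter d M) × Letter d M :=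
    fun q => (j :: q.1, q.2)
  have hf : Function.Injective f := fun q q' h => by simpa [f, Prod.ext_iff] using h
  have hA : MeasurableSet A := hI.measurableSet [] j
  have hA0 : μ A ≠ 0 := by
    intro h
    have := hI.prob [] j
    rw [Measure.real, h] at this
    simp at this
    exact hp.ne this
  have key : ∀ S : Finset (List (Letter d M) × Letter d M),
      ProbabilityTheory.cond μ A (⋂ q ∈ S, B (f q)) = ∏ q ∈ S, μ (B (f q)) := by
    intro S
    -- The root decision is not in the image of `f`, whose words are all nonempty, so it splits off
    -- as a factor.
    have h1 := hI.indep.meas_biInter (insert ([], j) (S.image f))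
    rw [Finset.set_biInter_insert, Finset.set_biInter_finset_image, Finset.prod_insert,
      Finset.prod_image hf.injOn] at h1
    · rw [cond_apply hA]
      change (μ A)⁻¹ * μ (A ∩ ⋂ q ∈ S, B (f q)) = _
      change μ (A ∩ ⋂ q ∈ S, B (f q)) = μ A * ∏ q ∈ S, μ (B (f q)) at h1
      rw [h1, ← mul_assoc, ENNReal.inv_mul_cancel hA0 (measure_ne_top _ _), one_mul]
    · simp [f]
  have key1 : ∀ q, ProbabilityTheory.cond μ A (B (f q)) = μ (B (f q)) := by
    intro q
    simpa using key {q}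
  refine ⟨fun σ l => hI.measurableSet (j :: σ) l, fun σ l => ?_, ?_⟩
  · rw [← hI.prob (j :: σ) l, Measure.real, Measure.real]
    exact congrArg ENNReal.toReal (key1 (σ, l))
  · refine (iIndepSet_iff_meas_biInter fun q : List (Letter d M) × Letter d M =>
      hI.measurableSet (j :: q.1) q.2).2 fun S => ?_
    refine (key S).trans (Finset.prod_congr rfl fun q _ => (key1 q).symm)

/-- The left side is `p` times a conditional expectation, which equals the unconditional one by
`cond` and uniqueness of the law. -/
lemma IsFractalPercolation.setIntegral_shift [IsProbabilityMeasure μ]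
    (hI : IsFractalPercolation μ p I) (hp : 0 < p) (j : Letter d M) (n : ℕ)
    (h : Set (List (Letter d M)) → ℝ) :
    ∫ ω in {ω | j ∈ I [] ω}, h (tree (fun σ => I (j :: σ)) ω n) ∂μ =
      p * ∫ ω, h (tree I ω n) ∂μ := by
  have hA0 : μ {ω | j ∈ I [] ω} ≠ 0 := by
    intro h
    have := hI.prob [] j
    rw [Measure.real, h] at this
    simp at this
    exact hp.ne this
  have := cond_isProbabilityMeasure hA0
  rw [hI.integral_tree_eq (hI.cond hp j), ProbabilityTheory.cond, integral_smul_measure,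
    ENNReal.toReal_inv]
  have := hI.prob [] j
  rw [Measure.real] at this
  rw [this, smul_eq_mul, mul_inv_cancel_left₀ hp.ne']

end FractalPercolation

namespace FractalPercolation

/-! ### Intersections of the parts of a construction step -/

variable {d M : ℕ} {k : Fin (d + 1)}

lemma abs_intrinsicVolume_le_of_subset_cube (hM : 0 < M) {σ : List (Letter d M)} {n : ℕ}
    (hσ : σ.length = n) {a b : Fin d → ℝ} (h : box a b ⊆ cube σ) :
    |intrinsicVolume d k (box a b)| ≤ 2 ^ d * ((1 / (M : ℝ)) ^ n) ^ (k : ℕ) := by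
  have hM' : (0 : ℝ) < M := by exact_mod_cast hM
  -- If the box is empty, `a` and `b` carry no size information; intersecting with the cube gives
  -- endpoints with controlled differences.
  have h1 : box a b = box a b ∩ cube σ := (Set.inter_eq_left.2 h).symm
  rw [h1, cube_eq_box hM, box_inter]
  refine abs_intrinsicVolume_box_le (by positivity) fun i => ?_
  refine (sub_le_sub (inf_le_right (a := b i)) (le_sup_right (a := a i))).trans ?_
  rw [← sub_div, hσ, one_div_pow]
  simp

variable (T : Finset (Letter d M))

/-- The cell determined by a family of words. -/
def cell (g : T → List (Letter d M)) : Set (E d) := ⋂ j ∈ (Finset.univ : Finset T), cube (g j)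

variable {T}

lemma mem_cell {g : T → List (Letter d M)} {x : E d} : x ∈ cell T g ↔ ∀ j, x ∈ cube (g j) := by
  simp [cell]

lemma exists_cell_eq_box (hM : 0 < M) (hT : T.Nonempty) (g : T → List (Letter d M)) :
    ∃ a b, cell T g = box a b :=
  have : Nonempty T := hT.to_subtype
  exists_biInter_eq_box (fun j => exists_cube_eq_box hM (g j)) Finset.univ_nonempty

variable (T)

open Classical in
/-- The families `g` of words of length `n`, one with each first letter `j ∈ T`, whose cubes have
a common point. -/
noncomputable def families (n : ℕ) : Finset (T → List (Letter d M)) :=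
  {g ∈ Fintype.piFinset fun _ : T => words d M n |
    (∀ j : T, (g j).head? = some j.1) ∧ (cell T g).Nonempty}

variable {T}

lemma mem_families {n : ℕ} {g : T → List (Letter d M)} : g ∈ families T n ↔
    (∀ j, (g j).length = n) ∧ (∀ j : T, (g j).head? = some j.1) ∧ (cell T g).Nonempty := by
  simp [families, mem_words]

/-- The word at `j` is a boundary word towards `l`, and every word of the family is a neighbour of
it. -/
lemma card_families_le (hM : 0 < M) {j l : Letter d M} (hj : j ∈ T) (hl : l ∈ T) (hjl : j ≠ l)
    (n : ℕ) :
    (families T (n + 1)).card ≤ (3 ^ d) ^ T.card * (2 * (M ^ (n + 1)) ^ (d - 1)) := by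
  classical
  have hmaps : ∀ g ∈ families T (n + 1), g ⟨j, hj⟩ ∈ boundaryWords j l (n + 1) := by
    intro g hg
    obtain ⟨h1, h2, x, hx⟩ := mem_families.1 hg
    have hx := mem_cell.1 hx
    exact Finset.mem_filter.2 ⟨mem_words.2 (h1 _), h2 _, g ⟨l, hl⟩, h1 _, h2 _, x, hx _, hx _⟩
  have hfibre : ∀ σ ∈ boundaryWords j l (n + 1),
      ({g ∈ families T (n + 1) | g ⟨j, hj⟩ = σ}).card ≤ (3 ^ d) ^ T.card := by
    intro σ hσ
    have hlen : σ.length = n + 1 := mem_words.1 (Finset.mem_filter.1 hσ).1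
    have hsub : {g ∈ families T (n + 1) | g ⟨j, hj⟩ = σ} ⊆
        Fintype.piFinset fun _ : T => neighbours (n + 1) σ := by
      intro g hg
      obtain ⟨hg, hgσ⟩ := Finset.mem_filter.1 hg
      obtain ⟨h1, _, x, hx⟩ := mem_families.1 hg
      have hx := mem_cell.1 hx
      exact Fintype.mem_piFinset.2 fun i => mem_neighbours.2 ⟨h1 i, x, hgσ ▸ hx ⟨j, hj⟩, hx i⟩
    refine (Finset.card_le_card hsub).trans ?_
    rw [Fintype.card_piFinset, Finset.prod_const, Finset.card_univ, Fintype.card_coe]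
    exact Nat.pow_le_pow_left (card_neighbours_le hM hlen) _
  calc (families T (n + 1)).card
      ≤ (3 ^ d) ^ T.card * (boundaryWords j l (n + 1)).card :=
        Finset.card_le_mul_card_image_of_maps_to hmaps _ hfibre
    _ ≤ _ := Nat.mul_le_mul le_rfl (card_boundaryWords_le hM hjl n)

variable {Ω : Type*} {I : List (Letter d M) → Ω → Set (Letter d M)}

open Classical in
lemma biInter_stepPart_eq (n : ℕ) (ω : Ω) :
    ⋂ j ∈ T, stepPart I j n ω =
      ⋃ g ∈ {g ∈ families T n | ∀ j, g j ∈ tree I ω n}, cell T g := by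
  ext x
  simp only [Set.mem_iInter, Set.mem_iUnion, stepPart, Finset.mem_filter, exists_prop]
  constructor
  · intro h
    have h' : ∀ j : T, ∃ σ ∈ {τ ∈ tree I ω n | τ.head? = some j.1}, x ∈ cube σ :=
      fun j => h j.1 j.2
    choose g hg hx using h'
    refine ⟨g, ⟨mem_families.2 ⟨fun j => length_of_mem_tree (hg j).1, fun j => (hg j).2, x, ?_⟩,
      fun j => (hg j).1⟩, ?_⟩ <;> exact mem_cell.2 hx
  · rintro ⟨g, ⟨hg, ht⟩, hx⟩ j hj
    exact ⟨g ⟨j, hj⟩, ⟨ht _, (mem_families.1 hg).2.1 _⟩, mem_cell.1 hx _⟩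

-- The intersection is a union of cells. Families of meeting cells are neighbours in every entry,
-- which bounds the multiplicity. Requiring survival only at `j` and `l` overcounts the cells and
-- leaves an event of known probability.
open Classical in
lemma abs_intrinsicVolume_biInter_stepPart_le (hM : 0 < M) {j l : Letter d M} (hj : j ∈ T)
    (hl : l ∈ T) (n : ℕ) (ω : Ω) :
    |intrinsicVolume d k (⋂ j ∈ T, stepPart I j n ω)| ≤
      (∑ g ∈ families T n, ({ω | g ⟨j, hj⟩ ∈ tree I ω n} ∩ {ω | g ⟨l, hl⟩ ∈ tree I ω n}).indicator
        (1 : Ω → ℝ) ω) * (2 ^ (3 ^ d) ^ T.card * (2 ^ d * ((1 / (M : ℝ)) ^ n) ^ (k : ℕ))) := by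
  have hT : T.Nonempty := ⟨j, hj⟩
  rw [biInter_stepPart_eq]
  refine (abs_intrinsicVolume_biUnion_le (B := (3 ^ d) ^ T.card)
    (R := 2 ^ d * ((1 / (M : ℝ)) ^ n) ^ (k : ℕ)) _ _ (fun g _ => ?_) (fun t ht hne => ?_)
    (fun g => Fintype.piFinset fun i => neighbours n (g i)) (fun g hg g' hg' h => ?_)
    (fun g hg => ?_)).trans (mul_le_mul_of_nonneg_right ?_ (by positivity))
  · obtain ⟨a, b, h⟩ := exists_cell_eq_box hM hT g
    exact h ▸ isPolyconvex_box a b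
  · obtain ⟨a, b, h⟩ := exists_biInter_eq_box (exists_cell_eq_box hM hT) hne
    obtain ⟨g, hg⟩ := hne
    have hlen := (mem_families.1 (Finset.mem_filter.1 (ht hg)).1).1 ⟨j, hj⟩
    rw [h]
    refine abs_intrinsicVolume_le_of_subset_cube hM hlen (h ▸ fun x hx => ?_)
    exact mem_cell.1 (Set.mem_iInter₂.1 hx g hg) _
  · obtain ⟨x, hx, hx'⟩ := h
    have hlen := (mem_families.1 (Finset.mem_filter.1 hg').1).1
    exact Fintype.mem_piFinset.2 fun i =>
      mem_neighbours.2 ⟨hlen i, x, mem_cell.1 hx i, mem_cell.1 hx' i⟩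
  · have hlen := (mem_families.1 (Finset.mem_filter.1 hg).1).1
    rw [Fintype.card_piFinset]
    refine (Finset.prod_le_prod' fun i _ => card_neighbours_le hM (hlen i)).trans ?_
    rw [Finset.prod_const, Finset.card_univ, Fintype.card_coe]
  · rw [Finset.card_eq_sum_ones, Finset.sum_filter, Nat.cast_sum]
    refine Finset.sum_le_sum fun g _ => ?_
    split_ifs with h
    · simp [h]
    · exact_mod_cast Set.indicator_nonneg (fun _ _ => zero_le_one) _

variable [MeasurableSpace Ω] {μ : Measure Ω} {p : ℝ}

lemma abs_integral_biInter_stepPart_le [IsProbabilityMeasure μ] (hM : 0 < M)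
    (hI : IsFractalPercolation μ p I) (hp : 0 < p) (hT : 2 ≤ T.card) (n : ℕ) :
    |∫ ω, intrinsicVolume d k (⋂ j ∈ T, stepPart I j (n + 1) ω) ∂μ| ≤
      (3 ^ d) ^ T.card * (2 * ((M : ℝ) ^ (n + 1)) ^ (d - 1)) * p ^ (2 * (n + 1)) *
        (2 ^ (3 ^ d) ^ T.card * (2 ^ d * ((1 / (M : ℝ)) ^ (n + 1)) ^ (k : ℕ))) := by
  obtain ⟨j, hj, l, hl, hjl⟩ := Finset.one_lt_card.1 hT
  have hmeas : ∀ g : T → List (Letter d M), MeasurableSet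
      ({ω | g ⟨j, hj⟩ ∈ tree I ω (n + 1)} ∩ {ω | g ⟨l, hl⟩ ∈ tree I ω (n + 1)}) := fun g =>
    (measurableSet_mem_tree hI.measurableSet _ _).inter
      (measurableSet_mem_tree hI.measurableSet _ _)
  have hint : ∀ g ∈ families T (n + 1), Integrable
      (({ω | g ⟨j, hj⟩ ∈ tree I ω (n + 1)} ∩ {ω | g ⟨l, hl⟩ ∈ tree I ω (n + 1)}).indicator
        (1 : Ω → ℝ)) μ := fun g _ => (integrable_const (1 : ℝ)).indicator (hmeas g)
  rw [← Real.norm_eq_abs]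
  refine (norm_integral_le_of_norm_le ((integrable_finsetSum' _ hint).mul_const
    (2 ^ (3 ^ d) ^ T.card * (2 ^ d * ((1 / (M : ℝ)) ^ (n + 1)) ^ (k : ℕ))))
    (Eventually.of_forall fun ω => (Real.norm_eq_abs _).le.trans ?_)).trans ?_
  · rw [Finset.sum_apply]
    exact abs_intrinsicVolume_biInter_stepPart_le hM hj hl (n + 1) ω
  · rw [integral_mul_const]
    refine mul_le_mul_of_nonneg_right ?_ (by positivity)
    simp only [Finset.sum_apply]
    rw [integral_finsetSum _ hint]
    have h1 : ∀ g ∈ families T (n + 1), ∫ ω,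
        ({ω | g ⟨j, hj⟩ ∈ tree I ω (n + 1)} ∩ {ω | g ⟨l, hl⟩ ∈ tree I ω (n + 1)}).indicator
          (1 : Ω → ℝ) ω ∂μ = p ^ (2 * (n + 1)) := by
      intro g hg
      obtain ⟨hlen, hhead, _⟩ := mem_families.1 hg
      rw [integral_indicator_one (hmeas g)]
      exact hI.measureReal_mem_tree_and (hlen _) (hlen _) (hhead _) (hhead _) hjl
    rw [Finset.sum_congr rfl h1, Finset.sum_const, nsmul_eq_mul]
    refine mul_le_mul_of_nonneg_right ?_ (by positivity)
    exact_mod_cast card_families_le hM hj hl hjl n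

/-! ### The recursion for the expected intrinsic volumes -/

lemma integrable_intrinsicVolume_step [IsFiniteMeasure μ] (hI : IsFractalPercolation μ p I)
    (n : ℕ) : Integrable (fun ω => intrinsicVolume d k (step I n ω)) μ :=
  integrable_comp_tree hI.measurableSet n fun A => intrinsicVolume d k (⋃ σ ∈ A, cube σ)

lemma integrable_intrinsicVolume_biInter_stepPart [IsFiniteMeasure μ]
    (hI : IsFractalPercolation μ p I) (T : Finset (Letter d M)) (n : ℕ) :
    Integrable (fun ω => intrinsicVolume d k (⋂ j ∈ T, stepPart I j n ω)) μ :=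
  integrable_comp_tree hI.measurableSet n fun A =>
    intrinsicVolume d k (⋂ j ∈ T, ⋃ σ ∈ {τ ∈ A | τ.head? = some j}, cube σ)

lemma integral_intrinsicVolume_stepPart [IsProbabilityMeasure μ] (hM : 0 < M)
    (hI : IsFractalPercolation μ p I) (hp : 0 < p) (j : Letter d M) (n : ℕ) :
    ∫ ω, intrinsicVolume d k (stepPart I j (n + 1) ω) ∂μ =
      p * (1 / (M : ℝ)) ^ (k : ℕ) * ∫ ω, intrinsicVolume d k (step I n ω) ∂μ := by
  classical
  have h1 : ∀ ω, intrinsicVolume d k (stepPart I j (n + 1) ω) =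
      {ω | j ∈ I [] ω}.indicator (fun ω => (1 / (M : ℝ)) ^ (k : ℕ) *
        intrinsicVolume d k (⋃ σ ∈ tree (fun σ => I (j :: σ)) ω n, cube σ)) ω := by
    intro ω
    rw [stepPart_succ]
    by_cases hj : j ∈ I [] ω
    · rw [if_pos hj, Set.indicator_of_mem (by exact hj)]
      have hA := (finite_tree (I := fun σ => I (j :: σ)) (ω := ω) n).coe_toFinset
      rw [step_eq_biUnion n _ hA, intrinsicVolume_phi_image hM j _ (exists_cube_eq_box hM),
        ← step_eq_biUnion n _ hA]
      rfl
    · rw [if_neg hj, Set.indicator_of_notMem (by exact hj), intrinsicVolume_empty]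
  simp only [h1]
  rw [integral_indicator (hI.measurableSet [] j), integral_const_mul,
    hI.setIntegral_shift hp j n fun A => intrinsicVolume d k (⋃ σ ∈ A, cube σ)]
  simp only [step]
  ring

/-- Inclusion–exclusion over first letters: the `M^d` singletons reproduce level `n`, and larger `T`
give the inhomogeneous term. -/
lemma integral_intrinsicVolume_step_succ [IsProbabilityMeasure μ] (hM : 0 < M)
    (hI : IsFractalPercolation μ p I) (hp : 0 < p) (n : ℕ) :
    ∫ ω, intrinsicVolume d k (step I (n + 1) ω) ∂μ =
      (M : ℝ) ^ d * p * (1 / (M : ℝ)) ^ (k : ℕ) * ∫ ω, intrinsicVolume d k (step I n ω) ∂μ +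
      ∑ T : Finset (Letter d M) with 2 ≤ T.card, (-1 : ℝ) ^ (T.card - 1) *
        ∫ ω, intrinsicVolume d k (⋂ j ∈ T, stepPart I j (n + 1) ω) ∂μ := by
  classical
  have hsplit : ∀ f : Finset (Letter d M) → ℝ,
      ∑ T ∈ (Finset.univ : Finset (Letter d M)).powerset with T.Nonempty, f T =
        ∑ j, f {j} + ∑ T : Finset (Letter d M) with 2 ≤ T.card, f T := by
    intro f
    have h1 : {T ∈ (Finset.univ : Finset (Letter d M)).powerset | T.Nonempty} =
        Finset.powersetCard 1 Finset.univ ∪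
          ({T | 2 ≤ T.card} : Finset (Finset (Letter d M))) := by
      ext T
      simp only [Finset.mem_filter, Finset.mem_powerset, Finset.subset_univ, true_and,
        Finset.mem_union, Finset.mem_powersetCard, Finset.mem_univ, ← Finset.card_pos]
      omega
    have h2 : Disjoint (Finset.powersetCard 1 (Finset.univ : Finset (Letter d M)))
        ({T | 2 ≤ T.card} : Finset (Finset (Letter d M))) := by
      rw [Finset.disjoint_left]
      intro T hT hT'
      have h3 := (Finset.mem_powersetCard.1 hT).2
      have h4 := (Finset.mem_filter.1 hT').2
      omega
    rw [h1, Finset.sum_union h2, Finset.powersetCard_one, Finset.sum_map]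
    rfl
  have h1 : ∀ ω, intrinsicVolume d k (step I (n + 1) ω) =
      ∑ j, intrinsicVolume d k (stepPart I j (n + 1) ω) +
      ∑ T : Finset (Letter d M) with 2 ≤ T.card, (-1 : ℝ) ^ (T.card - 1) *
        intrinsicVolume d k (⋂ j ∈ T, stepPart I j (n + 1) ω) := by
    intro ω
    have h := intrinsicVolume_biUnion (k := k) Finset.univ (fun j => stepPart I j (n + 1) ω)
      (fun j _ => isPolyconvex_stepPart hM j (n + 1))
    rw [hsplit] at h
    simpa [step_succ] using h
  have hint := integrable_intrinsicVolume_biInter_stepPart (k := k) hI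
  have hint1 : ∀ j, Integrable (fun ω => intrinsicVolume d k (stepPart I j (n + 1) ω)) μ := by
    intro j
    simpa using hint {j} (n + 1)
  simp only [h1]
  rw [integral_add (integrable_finsetSum _ fun j _ => hint1 j)
    (integrable_finsetSum _ fun T _ => (hint T (n + 1)).const_mul _),
    integral_finsetSum _ fun j _ => hint1 j,
    integral_finsetSum _ fun T _ => (hint T (n + 1)).const_mul _]
  simp only [integral_const_mul, integral_intrinsicVolume_stepPart hM hI hp, Finset.sum_const,
    Finset.card_univ, Fintype.card_fun, Fintype.card_fin, nsmul_eq_mul]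
  push_cast
  ring

/-- From `M^D = M^d p`: the real power becomes the `n`-th power of an explicit ratio, and logarithms
disappear from the argument. -/
lemma one_div_rpow_mul_dimension_sub (hM : 2 ≤ M) (hp : 0 < p) (n k : ℕ) :
    (1 / (M : ℝ)) ^ ((n : ℝ) * (dimension d M p - k)) =
      ((M : ℝ) ^ k / ((M : ℝ) ^ d * p)) ^ n := by
  have hM' : (1 : ℝ) < M := by exact_mod_cast hM
  have hM0 : (0 : ℝ) < M := by linarith
  have hlog : Real.log M ≠ 0 := (Real.log_pos hM').ne'
  have h1 : (M : ℝ) ^ dimension d M p = (M : ℝ) ^ d * p := by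
    rw [Real.rpow_def_of_pos hM0, dimension, mul_div_cancel₀ _ hlog, Real.exp_log (by positivity)]
  rw [mul_comm, Real.rpow_mul (by positivity), Real.rpow_natCast, one_div, Real.inv_rpow hM0.le,
    Real.rpow_sub hM0, h1, Real.rpow_natCast, inv_div]

end FractalPercolation

/-! ### Summability and passage to the limit -/

theorem theorem1 {d M : ℕ} (hM : 2 ≤ M) {p : ℝ} (hp : ((M : ℝ) ^ min 3 d)⁻¹ < p) (hp1 : p ≤ 1)
    {Ω : Type*} [MeasurableSpace Ω] (μ : Measure Ω) [IsProbabilityMeasure μ]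
    (I : List (Letter d M) → Ω → Set (Letter d M)) (hI : IsFractalPercolation μ p I)
    (k : Fin (d + 1)) :
    -- the expectations and the series in the formula are well defined
    (∀ n : ℕ, Integrable (fun ω => intrinsicVolume d k (step I n ω)) μ) ∧
    (∀ T : Finset (Letter d M), 2 ≤ T.card →
      (∀ n : ℕ, 1 ≤ n → Integrable (fun ω => intrinsicVolume d k (⋂ j ∈ T, stepPart I j n ω)) μ) ∧
      Summable fun n : ℕ => (1 / (M : ℝ)) ^ (((n + 1 : ℕ) : ℝ) * (dimension d M p - (k : ℕ))) *
        ∫ ω, intrinsicVolume d k (⋂ j ∈ T, stepPart I j (n + 1) ω) ∂μ) ∧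
    -- the rescaled limit exists and is given by the formula
    Tendsto (fun n : ℕ => (1 / (M : ℝ)) ^ ((n : ℝ) * (dimension d M p - (k : ℕ))) *
        ∫ ω, intrinsicVolume d k (step I n ω) ∂μ) atTop
      (𝓝 (intrinsicVolume d k (unitCube d) +
        ∑ T : Finset (Letter d M) with 2 ≤ T.card, (-1 : ℝ) ^ (T.card - 1) *
          ∑' n : ℕ, (1 / (M : ℝ)) ^ (((n + 1 : ℕ) : ℝ) * (dimension d M p - (k : ℕ))) *
            ∫ ω, intrinsicVolume d k (⋂ j ∈ T, stepPart I j (n + 1) ω) ∂μ)) := by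
  have hM0 : 0 < M := by omega
  have hMr : (0 : ℝ) < M := by exact_mod_cast hM0
  have hp0 : 0 < p := lt_trans (by positivity) hp
  -- For `d = 0` the lower bound on `p` reads `1 < p`. Positivity of `d` makes `M^{d-1} M = M^d`
  -- valid below.
  have hd : 0 < d := by
    rcases Nat.eq_zero_or_pos d with rfl | h
    · simp at hp; linarith
    · exact h
  have hsum : ∀ T : Finset (Letter d M), 2 ≤ T.card →
      Summable fun n : ℕ => (1 / (M : ℝ)) ^ (((n + 1 : ℕ) : ℝ) * (dimension d M p - (k : ℕ))) *
        ∫ ω, intrinsicVolume d k (⋂ j ∈ T, stepPart I j (n + 1) ω) ∂μ := by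
    intro T hT
    have hlt : p / M < 1 := by
      rw [div_lt_one hMr]
      have : (2 : ℝ) ≤ M := by exact_mod_cast hM
      linarith
    have hg := ((summable_nat_add_iff 1).2
      (summable_geometric_of_lt_one (by positivity) hlt)).mul_left
      ((3 ^ d) ^ T.card * 2 * (2 ^ (3 ^ d) ^ T.card * 2 ^ d) : ℝ)
    refine Summable.of_norm_bounded hg fun n => ?_
    rw [one_div_rpow_mul_dimension_sub hM hp0, norm_mul, Real.norm_of_nonneg (by positivity),
      Real.norm_eq_abs]
    refine (mul_le_mul_of_nonneg_left
      (abs_integral_biInter_stepPart_le hM0 hI hp0 hT n) (by positivity)).trans (le_of_eq ?_)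
    -- The geometric ratio is the product of the normalisation, the boundary count, the survival
    -- probability of a pair and the scaling of `V_k`.
    have h1 : p / M = (M : ℝ) ^ (k : ℕ) / ((M : ℝ) ^ d * p) * (M : ℝ) ^ (d - 1) * p ^ 2 *
        (1 / (M : ℝ)) ^ (k : ℕ) := by
      have hMd : (M : ℝ) ^ d = M ^ (d - 1) * M := by rw [← pow_succ, Nat.sub_add_cancel hd]
      rw [hMd, one_div_pow]
      field_simp
    rw [h1, pow_right_comm (1 / (M : ℝ)), pow_right_comm (M : ℝ) (n + 1), pow_mul p 2]
    simp only [mul_pow]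
    ring
  refine ⟨integrable_intrinsicVolume_step hI, fun T hT =>
    ⟨fun n _ => integrable_intrinsicVolume_biInter_stepPart hI T n, hsum T hT⟩, ?_⟩
  -- The recursion telescopes exactly, with no error term, so the limit is that of the partial sums.
  have hpartial : ∀ n : ℕ, (1 / (M : ℝ)) ^ ((n : ℝ) * (dimension d M p - (k : ℕ))) *
      ∫ ω, intrinsicVolume d k (step I n ω) ∂μ = intrinsicVolume d k (unitCube d) +
        ∑ T : Finset (Letter d M) with 2 ≤ T.card, (-1 : ℝ) ^ (T.card - 1) *
          ∑ m ∈ Finset.range n,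
            (1 / (M : ℝ)) ^ (((m + 1 : ℕ) : ℝ) * (dimension d M p - (k : ℕ))) *
              ∫ ω, intrinsicVolume d k (⋂ j ∈ T, stepPart I j (m + 1) ω) ∂μ := by
    intro n
    induction n with
    | zero => simp [step, tree, cube]
    | succ n ih =>
      simp only [Finset.sum_range_succ, mul_add, Finset.sum_add_distrib]
      rw [← add_assoc, ← ih, integral_intrinsicVolume_step_succ hM0 hI hp0, mul_add,
        Finset.mul_sum]
      simp only [one_div_rpow_mul_dimension_sub hM hp0]
      congr 1
      · rw [pow_succ, one_div_pow]
        field_simp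
      · exact Finset.sum_congr rfl fun T _ => by ring
  simp only [hpartial]
  refine tendsto_const_nhds.add (tendsto_finsetSum _ fun T hT => ?_)
  exact ((hsum T (Finset.mem_filter.1 hT).2).hasSum.tendsto_sum_nat).const_mul _
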